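/- **Conventions.** Let $X$ be a proper CAT(0) space with base-point $\mathfrak o$; geodesic rays are isometric embeddings $b:[0,\infty)\to X$ with $b(0)=\mathfrak o$. For a closed set $Z\subset X$ let $x_Z$ be the set of points of $Z$ nearest to $x$. The *Charney–Sultan contracting boundary* of $X$ is the set of geodesic rays $b$ that are $D$-contracting for some $D\ge 0$ (every ball disjoint from $b$ projects to a subset of $b$ of diameter at most $D$), with the direct limit topology over $D$ of the sets of $D$-contracting rays, each of which carries the subspace topology of the visual boundary. For a monotone, concave, sublinear function $\kappa:[0,\infty)\to[1,\infty)$, the *$\kappa$-Morse boundary* $\partial_\kappa X$ is the set of $\kappa$-contracting geodesic rays $b$, that is, those for which there is a constant $c$ such that $d(x,y)\le d(x,b)$ implies $\operatorname{diam}(x_b\cup y_b)\le c\,\kappa(d(\mathfrak o,x))$. Its topology is the visual topology on quasi-geodesics: a set $W$ is open if every $b\in W$ has some $\mathcal U_\kappa(b,r)\subset W$, where $\mathcal U_\kappa(b,r)$ is the set of $a\in\partial_\kappa X$ such that every continuous $(q,Q)$-quasi-geodesic ray from $\mathfrak o$ that $\kappa$-fellow travels $a$ and satisfies $m_b(q,Q)\le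 r/(2\kappa(r))$ stays, up to its first time at distance $r$ from $\mathfrak o$, in $\{x : d(x,b)\le m_b(q,Q)\,\kappa(d(\mathfrak o,x))\}$; here $m_b\ge\max(q,Q)$ is a Morse gauge of $b$: for all $r,n>0$ and every sublinear $\kappa'$ there is $R>0$ such that every $(q,Q)$-quasi-geodesic ray from $\mathfrak o$ with $m_b(q,Q)\le r/(2\kappa(r))$ that is within $n\,\kappa'(R)$ of $b$ at its first time at distance $R$ from $\mathfrak o$ stays in that neighbourhood of $b$ up to its first time at distance $r$. The *log-Morse boundary* is $\partial_\kappa X$ for $\kappa(t)=\log(e+t)$. **The spaces.** Let $X_A$ be the universal cover of the Salvetti complex of $A=\mathbb Z^2*\mathbb Z=\langle g_1,g_2,g_3\mid [g_1,g_2]\rangle$: a tree of flats tiled by squares, in which at every vertex of a flat one edge labelled $g_3$ starts and one ends. Fix a vertex $\mathfrak o$. A flat has height $n$ if the geodesic from $\mathfrak o$ to any of its points crosses $n$ edges labelled $g_3$. For $s:\mathbb N\to(0,\infty)$ let $X_s$ be $X_A$ with the path metric in which the squares of the flats of height $n$ are Euclidean squares of side $s(n)$ and the edges labelled $g_3$ have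 length $1$. Put $X_{\sqrt{\cdot}}=X_s$ for $s(n)=\max(1,\sqrt n)$ and $X_{\log}=X_s$ for $s(n)=\max(1,\log n)$ (with $s(0)=1$). **Corollary 6.4.** There exist two proper CAT(0) spaces that are not distinguishable by their Charney–Sultan contracting boundaries but are distinguishable by their log-Morse boundaries. Namely, $X_{\sqrt{\cdot}}$ and $X_{\log}$ are proper CAT(0) spaces, their Charney–Sultan contracting boundaries are homeomorphic, the log-Morse boundary of $X_{\sqrt{\cdot}}$ is countable, and that of $X_{\log}$ is uncountable; in particular the two log-Morse boundaries are not homeomorphic. -/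

import Mathlib

open Set Filter Topology
open scoped NNReal

noncomputable section

/-! ### CAT(0) spaces -/

/-- The Euclidean plane. -/
abbrev Plane : Type := EuclideanSpace ℝ (Fin 2)

/-- `γ`, restricted to `[0, dist p q]`, is a geodesic segment from `p` to `q`. -/
def IsGeodesicSegment {X : Type*} [MetricSpace X] (γ : ℝ → X) (p q : X) : Prop :=
  γ 0 = p ∧ γ (dist p q) = q ∧
    ∀ a ∈ Icc (0 : ℝ) (dist p q), ∀ b ∈ Icc (0 : ℝ) (dist p q), dist (γ a) (γ b) = |a - b|

/-- A geodesic metric space is CAT(0) if points on two sides `[p,q]`, `[p,r]` of a geodesic triangle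
are at most as far apart as the corresponding points of every Euclidean comparison triangle. -/
def IsCAT0 (X : Type*) [MetricSpace X] : Prop :=
  (∀ p q : X, ∃ γ : ℝ → X, IsGeodesicSegment γ p q) ∧
  ∀ (p q r : X) (γ δ : ℝ → X), IsGeodesicSegment γ p q → IsGeodesicSegment δ p r →
    ∀ p' q' r' : Plane, dist p' q' = dist p q → dist p' r' = dist p r → dist q' r' = dist q r →
      ∀ a ∈ Icc (0 : ℝ) (dist p q), ∀ b ∈ Icc (0 : ℝ) (dist p r),
        ∀ x' ∈ segment ℝ p' q', ∀ y' ∈ segment ℝ p' r', dist p' x' = a → dist p' y' = b →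
          dist (γ a) (δ b) ≤ dist x' y'

/-! ### Geodesic rays and quasi-geodesic rays from a base-point -/

/-- Geodesic rays starting at `o`. -/
structure GeodesicRay (X : Type*) [MetricSpace X] (o : X) where
  toFun : ℝ≥0 → X
  isometry : Isometry toFun
  map_zero : toFun 0 = o

/-- The image of a geodesic ray. -/
def GeodesicRay.image {X : Type*} [MetricSpace X] {o : X} (b : GeodesicRay X o) : Set X :=
  range b.toFun

/-- The cone topology of the visual boundary: uniform convergence of rays on compact sets. -/
instance GeodesicRay.instTopologicalSpace {X : Type*} [MetricSpace X] {o : X} :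
    TopologicalSpace (GeodesicRay X o) :=
  TopologicalSpace.induced
    (fun b => (⟨b.toFun, b.isometry.continuous⟩ : C(ℝ≥0, X))) inferInstance

/-- `β` is a (continuous) `(q, Q)`-quasi-geodesic ray starting at `o`. -/
def IsQuasiGeodesicRay {X : Type*} [MetricSpace X] (o : X) (q Q : ℝ) (β : ℝ≥0 → X) : Prop :=
  Continuous β ∧ β 0 = o ∧
    ∀ a b : ℝ≥0, (1 / q) * dist a b - Q ≤ dist (β a) (β b) ∧ dist (β a) (β b) ≤ q * dist a b + Q

/-- The set `x_Z` of points of `Z` that are nearest to `x`. -/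
def nearestPoints {X : Type*} [MetricSpace X] (Z : Set X) (x : X) : Set X :=
  {p | p ∈ Z ∧ dist x p = Metric.infDist x Z}

/-! ### The Charney–Sultan contracting boundary -/

/-- Every ball disjoint from the image of `b` projects to a subset of `b` of diameter at most `D`. -/
def GeodesicRay.IsContracting {X : Type*} [MetricSpace X] {o : X} (b : GeodesicRay X o)
    (D : ℝ≥0) : Prop :=
  ∀ (x : X) (ρ : ℝ), Disjoint (Metric.ball x ρ) b.image →
    ∀ y ∈ Metric.ball x ρ, ∀ y' ∈ Metric.ball x ρ,
      ∀ p ∈ nearestPoints b.image y, ∀ p' ∈ nearestPoints b.image y', dist p p' ≤ D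

/-- The contracting boundary, as a set: the rays that are `D`-contracting for some `D`. -/
def ContractingBoundary (X : Type*) [MetricSpace X] (o : X) : Type _ :=
  {b : GeodesicRay X o // ∃ D : ℝ≥0, b.IsContracting D}

/-- The inclusion of the set of `D`-contracting rays into the contracting boundary. -/
def ContractingBoundary.incl {X : Type*} [MetricSpace X] {o : X} (D : ℝ≥0)
    (b : {b : GeodesicRay X o // b.IsContracting D}) : ContractingBoundary X o :=
  ⟨b.1, D, b.2⟩

/-- The direct limit topology: the sets of `D`-contracting rays carry the subspace topology of the
visual boundary, and a set is open if its intersection with each of them is open. -/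
instance ContractingBoundary.instTopologicalSpace {X : Type*} [MetricSpace X] {o : X} :
    TopologicalSpace (ContractingBoundary X o) :=
  ⨆ D : ℝ≥0, TopologicalSpace.coinduced (ContractingBoundary.incl D) instTopologicalSpaceSubtype

/-! ### The `κ`-Morse boundary -/

/-- `κ : [0, ∞) → [1, ∞)` is monotone, concave and sublinear (values at negative numbers are
never used). -/
def IsSublinear (κ : ℝ → ℝ) : Prop :=
  (∀ t, 0 ≤ t → 1 ≤ κ t) ∧ MonotoneOn κ (Ici 0) ∧ ConcaveOn ℝ (Ici 0) κ ∧
    Tendsto (fun t => κ t / t) atTop (𝓝 0)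

/-- The logarithm, normalised so that it is a concave function from `[0, ∞)` to `[1, ∞)`. -/
def logGauge (t : ℝ) : ℝ := Real.log (Real.exp 1 + t)

/-- `𝒩_κ(Z, n)`, the `(κ, n)`-neighbourhood of `Z`, where `κ x` means `κ (dist o x)`. -/
def kappaNbhd {X : Type*} [MetricSpace X] (κ : ℝ → ℝ) (o : X) (Z : Set X) (n : ℝ) : Set X :=
  {x | Metric.infDist x Z ≤ n * κ (dist o x)}

/-- `Z` is `κ`-contracting: there is `c` such that `d(x,y) ≤ d(x,Z)` implies
`diam (x_Z ∪ y_Z) ≤ c κ(x)`. -/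
def IsKappaContracting {X : Type*} [MetricSpace X] (κ : ℝ → ℝ) (o : X) (Z : Set X) : Prop :=
  ∃ c : ℝ, ∀ x y : X, dist x y ≤ Metric.infDist x Z →
    ∀ p ∈ nearestPoints Z x ∪ nearestPoints Z y, ∀ p' ∈ nearestPoints Z x ∪ nearestPoints Z y,
      dist p p' ≤ c * κ (dist o x)

/-- Two rays (given as maps) `κ`-fellow travel. -/
def KappaFellowTravel {X : Type*} [MetricSpace X] (κ : ℝ → ℝ) (o : X) (α β : ℝ≥0 → X) : Prop :=
  (∃ n : ℝ, range α ⊆ kappaNbhd κ o (range β) n) ∧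
    (∃ n : ℝ, range β ⊆ kappaNbhd κ o (range α) n)

/-- `t_r`, the first time at which `β` is at distance `r` from `o`. -/
def firstTime {X : Type*} [MetricSpace X] (o : X) (β : ℝ≥0 → X) (r : ℝ) : ℝ≥0 :=
  sInf {t | dist o (β t) = r}

/-- A quantity `m` is small compared to the radius `r`. -/
def IsSmallComparedTo (κ : ℝ → ℝ) (m r : ℝ) : Prop :=
  m ≤ r / (2 * κ r)

/-- `m` is a (strong) Morse gauge of `Z`: for all `r, n > 0` and every sublinear `κ'` there is `R > 0`
such that every `(q, Q)`-quasi-geodesic ray with `m q Q` small compared to `r`, which at its first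
time at distance `R` from `o` is within `n κ'(R)` of `Z`, stays in the `(κ, m q Q)`-neighbourhood
of `Z` up to its first time at distance `r`. -/
def IsMorseGauge {X : Type*} [MetricSpace X] (κ : ℝ → ℝ) (o : X) (Z : Set X)
    (m : ℝ → ℝ → ℝ) : Prop :=
  (∀ q Q : ℝ, 1 ≤ q → 0 ≤ Q → max q Q ≤ m q Q) ∧
  ∀ r n : ℝ, 0 < r → 0 < n → ∀ κ' : ℝ → ℝ, IsSublinear κ' → ∃ R : ℝ, 0 < R ∧
    ∀ (q Q : ℝ) (η : ℝ≥0 → X), 1 ≤ q → 0 ≤ Q → IsQuasiGeodesicRay o q Q η →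
      IsSmallComparedTo κ (m q Q) r →
      Metric.infDist (η (firstTime o η R)) Z ≤ n * κ' R →
        η '' Iic (firstTime o η r) ⊆ kappaNbhd κ o Z (m q Q)

/-- The `κ`-Morse boundary `∂_κ X`, as a set: the `κ`-contracting geodesic rays from `o`. -/
def MorseBoundary (κ : ℝ → ℝ) (X : Type*) [MetricSpace X] (o : X) : Type _ :=
  {b : GeodesicRay X o // IsKappaContracting κ o b.image}

/-- The set `𝒰_κ(b, r)` (with respect to a Morse gauge `m` of `b`) of those `a` such that every
`(q, Q)`-quasi-geodesic ray `α` in the `κ`-fellow travelling class of `a`, with `m q Q` small compared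
to `r`, stays in the `(κ, m q Q)`-neighbourhood of `b` up to its first time at distance `r`. -/
def MorseBoundary.basicNbhd {κ : ℝ → ℝ} {X : Type*} [MetricSpace X] {o : X}
    (b : MorseBoundary κ X o) (m : ℝ → ℝ → ℝ) (r : ℝ) : Set (MorseBoundary κ X o) :=
  {a | ∀ (q Q : ℝ) (α : ℝ≥0 → X), 1 ≤ q → 0 ≤ Q → IsQuasiGeodesicRay o q Q α →
    KappaFellowTravel κ o α a.1.toFun → IsSmallComparedTo κ (m q Q) r →
      α '' Iic (firstTime o α r) ⊆ kappaNbhd κ o b.1.image (m q Q)}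

/-- The visual topology on quasi-geodesics: `W` is open if for every `b ∈ W` some `𝒰_κ(b, r)` is
contained in `W`. The sets `𝒰_κ(b, r)` decrease as `r` grows, so "some `r`" is the same as "all large
`r`"; different Morse gauges of `b` give the same neighbourhoods of `b`. -/
instance MorseBoundary.instTopologicalSpace {κ : ℝ → ℝ} {X : Type*} [MetricSpace X] {o : X} :
    TopologicalSpace (MorseBoundary κ X o) where
  IsOpen W := ∀ b ∈ W, ∀ m : ℝ → ℝ → ℝ, IsMorseGauge κ o b.1.image m →
    ∀ᶠ r in atTop, b.basicNbhd m r ⊆ W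
  isOpen_univ := fun _ _ _ _ => Eventually.of_forall fun _ => subset_univ _
  isOpen_inter := fun _ _ hU hV b hb m hm =>
    ((hU b hb.1 m hm).and (hV b hb.2 m hm)).mono fun _ h => subset_inter h.1 h.2
  isOpen_sUnion := fun _ hS b hb m hm => by
    obtain ⟨U, hU, hbU⟩ := hb
    exact (hS U hU b hbU m hm).mono fun _ h => h.trans (subset_sUnion_of_mem hU)

/-! ### Rescaled trees of flats

The universal cover of the Salvetti complex of `A = ⟨g₁, g₂, g₃ | [g₁, g₂]⟩ = ℤ² * ℤ` consists of
flats, one for each coset `g ⟨g₁, g₂⟩`, tiled by squares, and edges labelled `g₃`; at each vertex of a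
flat exactly one edge labelled `g₃` starts and exactly one ends. By the normal form in `ℤ² * ℤ`, the
cosets are the `v₁ g₃^{ε₁} v₂ g₃^{ε₂} ⋯ vₙ g₃^{εₙ} ⟨g₁, g₂⟩` with `vᵢ ∈ ℤ²`, `εᵢ = ±1`, and not both
`vᵢ₊₁ = 0` and `εᵢ₊₁ = -εᵢ`. The number `n` is the height of the flat. We rescale the flats of
height `n` so that their squares have side `s n`; the edges labelled `g₃` have length `1`. -/

/-- A letter `((i, j), ε)` stands for `g₁ ^ i * g₂ ^ j * g₃ ^ (±1)`, with `+1` for `ε = true`: walk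
from the vertex at which the flat was entered to the vertex at lattice position `(i, j)` relative to
it, and cross the outgoing (`true`) or the incoming (`false`) edge labelled `g₃` there. -/
abbrev FlatLetter : Type := (ℤ × ℤ) × Bool

/-- The words that index the flats, last letter first: no edge is crossed back at once. -/
def IsReducedWord (w : List FlatLetter) : Prop :=
  List.IsChain (fun a a' : FlatLetter => ¬ (a.1 = 0 ∧ a.2 ≠ a'.2)) w

/-- The points of the tree of flats with square sides `s`.  A point with `t = 1` is the point `pos` of
the flat `word`, in Euclidean coordinates whose origin is the vertex at which the flat is entered (the
base-point, for the flat `[]`).  A point with `t < 1` is an interior point of the edge that joins the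
flat `word` to the preceding one, at distance `t` from the preceding flat. -/
@[ext]
structure TreeOfFlats (s : ℕ → ℝ) where
  word : List FlatLetter
  reduced : IsReducedWord word
  pos : Plane
  t : ℝ
  t_pos : 0 < t
  t_le_one : t ≤ 1
  of_t_lt_one : t < 1 → word ≠ [] ∧ pos = 0

namespace TreeOfFlats

variable {s : ℕ → ℝ}

/-- The position in the flat `u` at which the path to the flat `w` leaves `u` (and `0` if it does not
visit `u` before `w`); a flat of height `n` has square side `s n`. -/
def exitPos (s : ℕ → ℝ) (u : List FlatLetter) : List FlatLetter → Plane
  | [] => 0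
  | a :: w => if w = u then s u.length • !₂[(a.1.1 : ℝ), (a.1.2 : ℝ)] else exitPos s u w

/-- The nearest-point projection of `x` to the flat `u`, in the coordinates of that flat. It is `0`, the
vertex where `u` is entered, unless `u` is the flat of `x` or is crossed on the way to `x`. -/
def flatCoord (x : TreeOfFlats s) (u : List FlatLetter) : Plane :=
  if x.word = u then x.pos else exitPos s u x.word

/-- The nearest-point projection of `x` to the edge `[0, 1]` that leads to the flat `u`. (There is no
edge for `u = []`; the value is then always `1`.) -/
def edgeCoord (x : TreeOfFlats s) (u : List FlatLetter) : ℝ :=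
  if x.word = u then x.t else if u <:+ x.word then 1 else 0

theorem exitPos_eq_zero {u : List FlatLetter} :
    ∀ {w : List FlatLetter}, ¬ u <:+ w → exitPos s u w = 0
  | [], _ => rfl
  | a :: w, h => by
    have h' : ¬ u <:+ w := fun h' => h (h'.trans (List.suffix_cons a w))
    have hw : w ≠ u := fun e => h' (e ▸ List.suffix_refl w)
    simp only [exitPos, if_neg hw]
    exact exitPos_eq_zero h'

theorem flatCoord_eq_zero {x : TreeOfFlats s} {u : List FlatLetter} (h : ¬ u <:+ x.word) :
    x.flatCoord u = 0 := by
  have hw : x.word ≠ u := fun e => h (e ▸ List.suffix_refl _)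
  simp only [flatCoord, if_neg hw]
  exact exitPos_eq_zero h

theorem edgeCoord_eq_zero {x : TreeOfFlats s} {u : List FlatLetter} (h : ¬ u <:+ x.word) :
    x.edgeCoord u = 0 := by
  have hw : x.word ≠ u := fun e => h (e ▸ List.suffix_refl _)
  simp only [edgeCoord, if_neg hw, if_neg h]

/-- The flats that are met on the way from the base-point to `x`. -/
def flatsTo (x : TreeOfFlats s) : Finset (List FlatLetter) :=
  x.word.tails.toFinset

theorem mem_flatsTo {x : TreeOfFlats s} {u : List FlatLetter} :
    u ∈ x.flatsTo ↔ u <:+ x.word := by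
  simp [flatsTo]

/-- The length of the part of the geodesic from `x` to `y` in the flat `u` and the edge leading to it. -/
def pieceDist (x y : TreeOfFlats s) (u : List FlatLetter) : ℝ :=
  dist (x.flatCoord u) (y.flatCoord u) + |x.edgeCoord u - y.edgeCoord u|

theorem pieceDist_nonneg (x y : TreeOfFlats s) (u : List FlatLetter) : 0 ≤ pieceDist x y u :=
  add_nonneg dist_nonneg (abs_nonneg _)

/-- The path metric: a geodesic crosses a sequence of flats and edges, which are glued at single points,
and its length is the sum of the lengths of the parts in the flats and in the edges. -/
instance instDist : Dist (TreeOfFlats s) where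
  dist x y := ∑ u ∈ x.flatsTo ∪ y.flatsTo, pieceDist x y u

theorem dist_eq_sum (x y : TreeOfFlats s) {S : Finset (List FlatLetter)}
    (h : x.flatsTo ∪ y.flatsTo ⊆ S) : dist x y = ∑ u ∈ S, pieceDist x y u := by
  refine Finset.sum_subset h fun u _ hu => ?_
  rw [Finset.mem_union, mem_flatsTo, mem_flatsTo, not_or] at hu
  simp [pieceDist, flatCoord_eq_zero hu.1, flatCoord_eq_zero hu.2, edgeCoord_eq_zero hu.1,
    edgeCoord_eq_zero hu.2]

theorem pieceDist_eq_zero {x y : TreeOfFlats s} (h : dist x y = 0) (u : List FlatLetter) :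
    x.flatCoord u = y.flatCoord u ∧ x.edgeCoord u = y.edgeCoord u := by
  have h1 : pieceDist x y u = 0 := by
    rw [dist_eq_sum x y (Finset.subset_insert u _)] at h
    exact (Finset.sum_eq_zero_iff_of_nonneg fun v _ => pieceDist_nonneg x y v).1 h u
      (Finset.mem_insert_self u _)
  have h2 : 0 ≤ dist (x.flatCoord u) (y.flatCoord u) := dist_nonneg
  have h3 := abs_nonneg (x.edgeCoord u - y.edgeCoord u)
  unfold pieceDist at h1
  exact ⟨dist_eq_zero.1 (by linarith), sub_eq_zero.1 (abs_eq_zero.1 (by linarith))⟩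

theorem suffix_of_dist_eq_zero {x y : TreeOfFlats s} (h : dist x y = 0) : x.word <:+ y.word := by
  by_contra hn
  have h1 := (pieceDist_eq_zero h x.word).2
  rw [edgeCoord_eq_zero hn] at h1
  simp only [edgeCoord, if_true] at h1
  exact x.t_pos.ne' h1

theorem dist_comm' (x y : TreeOfFlats s) : dist x y = dist y x := by
  rw [dist_eq_sum x y (Finset.Subset.refl _), Finset.union_comm,
    dist_eq_sum y x (Finset.Subset.refl _)]
  exact Finset.sum_congr rfl fun u _ => by
    rw [pieceDist, pieceDist, dist_comm, abs_sub_comm]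

instance instMetricSpace : MetricSpace (TreeOfFlats s) where
  dist_self x := by
    rw [dist_eq_sum x x (Finset.Subset.refl _)]
    simp [pieceDist]
  dist_comm := dist_comm'
  dist_triangle x y z := by
    rw [dist_eq_sum (S := x.flatsTo ∪ y.flatsTo ∪ z.flatsTo) x z (by grind),
      dist_eq_sum (S := x.flatsTo ∪ y.flatsTo ∪ z.flatsTo) x y (by grind),
      dist_eq_sum (S := x.flatsTo ∪ y.flatsTo ∪ z.flatsTo) y z (by grind),
      ← Finset.sum_add_distrib]
    refine Finset.sum_le_sum fun u _ => ?_
    have h1 := dist_triangle (x.flatCoord u) (y.flatCoord u) (z.flatCoord u)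
    have h2 := abs_sub_le (x.edgeCoord u) (y.edgeCoord u) (z.edgeCoord u)
    unfold pieceDist
    linarith
  eq_of_dist_eq_zero {x y} h := by
    have hw : x.word = y.word :=
      (suffix_of_dist_eq_zero h).eq_of_length_le
        (suffix_of_dist_eq_zero ((dist_comm' y x).trans h)).length_le
    have h1 := pieceDist_eq_zero h x.word
    simp only [flatCoord, edgeCoord, hw, if_true] at h1
    exact TreeOfFlats.ext hw h1.1 h1.2

/-- The base-point: the origin of the flat of height `0`. -/
def base (s : ℕ → ℝ) : TreeOfFlats s where
  word := []
  reduced := List.isChain_nil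
  pos := 0
  t := 1
  t_pos := one_pos
  t_le_one := le_rfl
  of_t_lt_one h := absurd h (lt_irrefl 1)

end TreeOfFlats

/-- Square sides `√n` at height `n` (and `1` at height `0`). -/
def sqrtScale (n : ℕ) : ℝ := max 1 (Real.sqrt n)

/-- Square sides `log n` at height `n ≥ 3` (and `1` at heights `0`, `1`, `2`). -/
def logScale (n : ℕ) : ℝ := max 1 (Real.log n)

end

/-! A point of a tree of flats is recorded by its projections to all flats and edges, and the metric
is the sum of the distances of these projections. Any two pieces form a wedge (`wedge`), so
betweenness can be tested piece by piece (`dist_add_dist_iff`). A geodesic triangle is then a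
Euclidean triangle in at most one piece, with legs attached to its corners. The legs preserve
Stewart's inequality (`stewart`), and applying that inequality twice gives CAT(0). Balls are compact
because edges have length 1 and squares have side at least 1, so that a ball meets finitely many
flats.

The contraction of a ray is governed by the lengths of the segments that it cuts out of the flats. A
segment of length `ℓ`, traversed by time `t`, produces two points with projections `ℓ / 2` apart, at
distance less than that of the first point from the ray; the first point is within `2 t` of the
base-point (`exists_projection_pair`). Conversely, an edge of the ray separates the space, so for a
ray that runs horizontally through its flats, `d(x,y) ≤ d(x,b)` confines the projections of `x` and
`y` to a stretch no longer than one such segment (`dist_nearestPoints_le`).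

If the scale tends to infinity, a `D`-contracting ray has only zero letters beyond some height.
Reducedness then fixes the signs, so finitely many letters, all bounded, determine the ray: there
are finitely many `D`-contracting rays (`finite_isContracting`). Hence both contracting boundaries
are discrete and countably infinite, and so homeomorphic.

A log-contracting ray has segments at most logarithmic in time, and the time needed to reach height
`n` is at most about `n` times the longest segment so far. With sides `√n`, a nonzero letter at
height `n` makes `n` at most a squared logarithm of the time, so the time is below a cubed logarithm
of itself; this fails far out, so each ray is determined by a finite word
(`countable_isKappaContracting`). With sides `log n`, every sequence of horizontal letters 0 and 1
gives a log-contracting ray (`uncountable_morseBoundary`). Cardinality alone separates the two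
log-Morse boundaries. -/

/-! ### Stewart's inequality and triangles with legs -/

/-- A leg of length `B` is attached at the end `q` of the base `α + β`. With `k` as below the
hypothesis reads `P² ≥ g² + α² + 2αk`; since `|k| ≤ g` it gives `P ≥ α + k`, which is what the extra
terms in `B` need. -/
theorem stewart_leg {α β P R g B : ℝ} (hα : 0 ≤ α) (hβ : 0 ≤ β) (hg : 0 ≤ g) (hP : 0 ≤ P)
    (hB : 0 ≤ B) (hR : 0 ≤ R)
    (h : (α + β) * g ^ 2 + α * β * (α + β) ≤ β * P ^ 2 + α * R ^ 2)
    (t1 : R ≤ g + β) (t2 : g ≤ R + β) (t3 : β ≤ g + R) :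
    (α + B + β) * g ^ 2 + (α + B) * β * (α + B + β) ≤ β * (P + B) ^ 2 + (α + B) * R ^ 2 := by
  rcases hβ.eq_or_lt with rfl | hβ
  · obtain rfl : R = g := by linarith
    nlinarith
  -- By the law of cosines, `k` is `g` times the cosine of the Euclidean angle between the sides `g`
  -- and `β`; the triangle inequalities bound it by `g`.
  set k := (g ^ 2 + β ^ 2 - R ^ 2) / (2 * β) with hk
  have hk' : 2 * β * k = g ^ 2 + β ^ 2 - R ^ 2 := by rw [hk]; field_simp
  have hkg : k ≤ g := by
    have : 2 * β * k ≤ 2 * β * g := by nlinarith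
    exact le_of_mul_le_mul_left this (by linarith)
  have hgk : -g ≤ k := by
    have : 2 * β * (-g) ≤ 2 * β * k := by nlinarith
    exact le_of_mul_le_mul_left this (by linarith)
  have h1 : β * ((α + k) ^ 2) ≤ β * P ^ 2 := by
    have h2 : k ^ 2 ≤ g ^ 2 := sq_le_sq' hgk hkg
    nlinarith
  have h3 : α + k ≤ P := abs_le_of_sq_le_sq' (le_of_mul_le_mul_left h1 hβ) hP |>.2
  have h4 : 0 ≤ B * (2 * β * (P - α - k)) := by
    apply mul_nonneg hB; apply mul_nonneg (by linarith); linarith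
  nlinarith

/-- A stem of length `A` at the apex adds `A` to all three distances. After expanding, what remains
is the convexity bound `(α + β) g ≤ βP + αR`, which follows from the hypothesis and `|P - R| ≤ α +
β`. -/
theorem stewart_stem {α β P R g A : ℝ} (hα : 0 ≤ α) (hβ : 0 ≤ β) (hP : 0 ≤ P)
    (hA : 0 ≤ A) (hR : 0 ≤ R)
    (h : (α + β) * g ^ 2 + α * β * (α + β) ≤ β * P ^ 2 + α * R ^ 2)
    (t1 : P ≤ R + (α + β)) (t2 : R ≤ P + (α + β)) :
    (α + β) * (g + A) ^ 2 + α * β * (α + β) ≤ β * (P + A) ^ 2 + α * (R + A) ^ 2 := by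
  have h1 : ((α + β) * g) ^ 2 ≤ (β * P + α * R) ^ 2 := by
    have h2 : (P - R) ^ 2 ≤ (α + β) ^ 2 := sq_le_sq' (by linarith) (by linarith)
    have h3 := mul_le_mul_of_nonneg_left h2 (mul_nonneg hα hβ)
    have h4 := mul_le_mul_of_nonneg_left h (add_nonneg hα hβ)
    nlinarith
  have h2 : (α + β) * g ≤ β * P + α * R := (abs_le_of_sq_le_sq' h1 (by positivity)).2
  nlinarith

theorem stewart_euclidean {E : Type*} [NormedAddCommGroup E] [InnerProductSpace ℝ E]
    (p q z r : E) (h : dist q z + dist z r = dist q r) :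
    dist q r * dist p z ^ 2 + dist q z * dist z r * dist q r =
      dist z r * dist p q ^ 2 + dist q z * dist p r ^ 2 := by
  obtain ⟨θ, ⟨h0, h1⟩, rfl⟩ := dist_add_dist_eq_iff.1 h
  rw [dist_left_lineMap, dist_lineMap_right, Real.norm_of_nonneg h0,
    Real.norm_of_nonneg (sub_nonneg.2 h1)]
  have key : dist p (AffineMap.lineMap q r θ) ^ 2 =
      (1 - θ) * dist p q ^ 2 + θ * dist p r ^ 2 - θ * (1 - θ) * dist q r ^ 2 := by
    have e1 : p - AffineMap.lineMap q r θ = (1 - θ) • (p - q) + θ • (p - r) := by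
      rw [AffineMap.lineMap_apply_module]; module
    have e2 : q - r = (p - r) - (p - q) := by abel
    simp only [dist_eq_norm]
    rw [e1, e2, ← real_inner_self_eq_norm_sq, ← real_inner_self_eq_norm_sq,
      ← real_inner_self_eq_norm_sq, ← real_inner_self_eq_norm_sq]
    simp only [inner_add_left, inner_add_right, inner_sub_left, inner_sub_right,
      real_inner_smul_right, real_inner_comm]
    ring
  rw [key]; ring

/-! ### Coordinates in flats and edges, and Stewart's inequality -/

namespace TreeOfFlats

variable {s : ℕ → ℝ}

/-- The projection of `x` to the flat `i.1` if `i.2` is true, and otherwise to the edge leading to it,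
which is placed on the first coordinate axis of the plane. -/
noncomputable def coord (x : TreeOfFlats s) (i : List FlatLetter × Bool) : Plane :=
  if i.2 then x.flatCoord i.1 else EuclideanSpace.single 0 (x.edgeCoord i.1)

theorem coord_true (x : TreeOfFlats s) (u : List FlatLetter) :
    x.coord (u, true) = x.flatCoord u := rfl

theorem coord_false (x : TreeOfFlats s) (u : List FlatLetter) :
    x.coord (u, false) = EuclideanSpace.single 0 (x.edgeCoord u) := rfl

theorem dist_coord_false (x y : TreeOfFlats s) (u : List FlatLetter) :
    dist (x.coord (u, false)) (y.coord (u, false)) = |x.edgeCoord u - y.edgeCoord u| := by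
  rw [coord_false, coord_false, PiLp.dist_single_same, Real.dist_eq]

/-- Any finite `T` containing the support is allowed, so that several distances can be summed over
one index set. -/
theorem dist_eq_sum_coord (x y : TreeOfFlats s) {T : Finset (List FlatLetter × Bool)}
    (h : ∀ i, x.coord i ≠ y.coord i → i ∈ T) :
    dist x y = ∑ i ∈ T, dist (x.coord i) (y.coord i) := by
  have h1 : dist x y = ∑ i ∈ (x.flatsTo ∪ y.flatsTo) ×ˢ (Finset.univ : Finset Bool),
      dist (x.coord i) (y.coord i) := by
    rw [dist_eq_sum x y (Finset.Subset.refl _), Finset.sum_product]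
    refine Finset.sum_congr rfl fun u _ => ?_
    rw [Fintype.sum_bool, dist_coord_false]; rfl
  have h2 : ∀ i, x.coord i ≠ y.coord i →
      i ∈ (x.flatsTo ∪ y.flatsTo) ×ˢ (Finset.univ : Finset Bool) := by
    rintro ⟨u, e⟩ hi
    by_contra hn
    simp only [Finset.mem_product, Finset.mem_union, mem_flatsTo, Finset.mem_univ, and_true,
      not_or] at hn
    apply hi
    cases e
    · rw [coord_false, coord_false, edgeCoord_eq_zero hn.1, edgeCoord_eq_zero hn.2]
    · rw [coord_true, coord_true, flatCoord_eq_zero hn.1, flatCoord_eq_zero hn.2]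
  rw [h1, Finset.sum_subset (Finset.subset_union_left (s₂ := T)),
    ← Finset.sum_subset (Finset.subset_union_right)]
  · intro i _ hi
    exact dist_eq_zero.2 (not_imp_comm.1 (h i) hi)
  · intro i _ hi
    exact dist_eq_zero.2 (not_imp_comm.1 (h2 i) hi)

theorem exists_support (x y : TreeOfFlats s) :
    ∃ T : Finset (List FlatLetter × Bool), ∀ i, x.coord i ≠ y.coord i → i ∈ T := by
  refine ⟨(x.flatsTo ∪ y.flatsTo) ×ˢ (Finset.univ : Finset Bool), ?_⟩
  rintro ⟨u, e⟩ hi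
  by_contra hn
  simp only [Finset.mem_product, Finset.mem_union, mem_flatsTo, Finset.mem_univ, and_true,
    not_or] at hn
  apply hi
  cases e
  · rw [coord_false, coord_false, edgeCoord_eq_zero hn.1, edgeCoord_eq_zero hn.2]
  · rw [coord_true, coord_true, flatCoord_eq_zero hn.1, flatCoord_eq_zero hn.2]

theorem dist_coord_le (x y : TreeOfFlats s) (i : List FlatLetter × Bool) :
    dist (x.coord i) (y.coord i) ≤ dist x y := by
  obtain ⟨T, hT⟩ := exists_support x y
  rw [dist_eq_sum_coord (T := insert i T) x y fun j hj => Finset.mem_insert_of_mem (hT j hj)]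
  exact Finset.single_le_sum (f := fun i => dist (x.coord i) (y.coord i))
    (fun _ _ => dist_nonneg) (Finset.mem_insert_self i T)

/-- Betweenness can be checked in each flat and each edge. -/
theorem dist_add_dist_iff (x z y : TreeOfFlats s) :
    dist x z + dist z y = dist x y ↔
      ∀ i, dist (x.coord i) (z.coord i) + dist (z.coord i) (y.coord i) =
        dist (x.coord i) (y.coord i) := by
  classical
  obtain ⟨T1, h1⟩ := exists_support x z
  obtain ⟨T2, h2⟩ := exists_support z y
  obtain ⟨T3, h3⟩ := exists_support x y
  set T := T1 ∪ T2 ∪ T3 with hT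
  rw [dist_eq_sum_coord (T := T) x z (by grind), dist_eq_sum_coord (T := T) z y (by grind),
    dist_eq_sum_coord (T := T) x y (by grind), ← Finset.sum_add_distrib, eq_comm,
    Finset.sum_eq_sum_iff_of_le fun i _ => dist_triangle _ _ _]
  constructor
  · intro h i
    by_cases hi : i ∈ T
    · exact (h i hi).symm
    · rw [not_imp_comm.1 (h1 i) (by grind), not_imp_comm.1 (h2 i) (by grind)]
      simp
  · exact fun h i _ => (h i).symm

theorem dist_add_dist_of_coord {x z y : TreeOfFlats s}
    (h : ∀ i, z.coord i = x.coord i ∨ z.coord i = y.coord i) :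
    dist x z + dist z y = dist x y := by
  refine (dist_add_dist_iff x z y).2 fun i => ?_
  rcases h i with h | h <;> simp [h]

theorem exitPos_of_suffix {u v : List FlatLetter} (huv : v <:+ u) (hne : v ≠ u) :
    ∀ {w : List FlatLetter}, u <:+ w → exitPos s v w = exitPos s v u
  | [], h => by rw [List.suffix_nil.1 h]
  | a :: w, h => by
    rcases List.suffix_cons_iff.1 h with h | h
    · rw [h]
    · have hw : w ≠ v := by
        rintro rfl
        exact hne (huv.eq_of_length_le h.length_le)
      rw [exitPos, if_neg hw, exitPos_of_suffix huv hne h]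

theorem flatCoord_of_suffix {x : TreeOfFlats s} {u v : List FlatLetter} (huv : v <:+ u)
    (hne : v ≠ u) (h : u <:+ x.word) : x.flatCoord v = exitPos s v u := by
  have hw : x.word ≠ v := by
    rintro hw
    exact hne (huv.eq_of_length_le (hw ▸ h.length_le))
  rw [flatCoord, if_neg hw, exitPos_of_suffix huv hne h]

theorem edgeCoord_of_suffix {x : TreeOfFlats s} {u v : List FlatLetter} (huv : v <:+ u)
    (hne : v ≠ u) (h : u <:+ x.word) : x.edgeCoord v = 1 := by
  have hw : x.word ≠ v := by
    rintro hw
    exact hne (huv.eq_of_length_le (hw ▸ h.length_le))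
  rw [edgeCoord, if_neg hw, if_pos (huv.trans h)]

theorem flatCoord_eq_zero_or (x : TreeOfFlats s) (u : List FlatLetter) :
    x.flatCoord u = 0 ∨ x.edgeCoord u = 1 := by
  by_cases h : x.word = u
  · rcases x.t_le_one.lt_or_eq with h1 | h1
    · left; rw [flatCoord, if_pos h, (x.of_t_lt_one h1).2]
    · right; rw [edgeCoord, if_pos h, h1]
  · by_cases h2 : u <:+ x.word
    · right; rw [edgeCoord, if_neg h, if_pos h2]
    · left; exact flatCoord_eq_zero h2

/-- Any two pieces span a wedge: a point can move away from the base-point of only one of them. -/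
theorem wedge {i j : List FlatLetter × Bool} (hij : i ≠ j) :
    ∃ a b : Plane, (i.2 = false → a = EuclideanSpace.single 0 0 ∨ a = EuclideanSpace.single 0 1) ∧
      ∀ x : TreeOfFlats s, x.coord i = a ∨ x.coord j = b := by
  have hz : (EuclideanSpace.single 0 0 : Plane) = 0 := (PiLp.single_eq_zero_iff 2 _).2 rfl
  have zero : ∀ {x : TreeOfFlats s} {i : List FlatLetter × Bool}, ¬ i.1 <:+ x.word →
      x.coord i = 0 := by
    rintro x ⟨u, e⟩ h
    cases e
    · rw [coord_false, edgeCoord_eq_zero h, hz]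
    · exact flatCoord_eq_zero h
  -- A point with nonzero coordinate in `j` has left the piece `i` at the exit leading towards `j`,
  -- so its coordinate in `i` is prescribed.
  have strict : ∀ i j : List FlatLetter × Bool, i.1 <:+ j.1 → i.1 ≠ j.1 → ∃ a : Plane,
      (i.2 = false → a = EuclideanSpace.single 0 0 ∨ a = EuclideanSpace.single 0 1) ∧
      ∀ x : TreeOfFlats s, x.coord i = a ∨ x.coord j = 0 := by
    rintro ⟨u, e⟩ j h hne
    cases e
    · refine ⟨EuclideanSpace.single 0 1, fun _ => Or.inr rfl, fun x => ?_⟩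
      by_cases hx : j.1 <:+ x.word
      · left; rw [coord_false, edgeCoord_of_suffix h hne hx]
      · exact Or.inr (zero hx)
    · refine ⟨exitPos s u j.1, fun h => by simp at h, fun x => ?_⟩
      by_cases hx : j.1 <:+ x.word
      · left; rw [coord_true, flatCoord_of_suffix h hne hx]
      · exact Or.inr (zero hx)
  by_cases huv : i.1 = j.1
  · obtain ⟨u, e⟩ := i
    obtain ⟨v, f⟩ := j
    obtain rfl : u = v := huv
    cases e <;> cases f
    · exact absurd rfl hij
    · refine ⟨EuclideanSpace.single 0 1, 0, fun _ => Or.inr rfl, fun x => ?_⟩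
      rcases x.flatCoord_eq_zero_or u with h | h
      · right; exact h
      · left; rw [coord_false, h]
    · refine ⟨0, EuclideanSpace.single 0 1, fun h => by simp at h, fun x => ?_⟩
      rcases x.flatCoord_eq_zero_or u with h | h
      · left; exact h
      · right; rw [coord_false, h]
    · exact absurd rfl hij
  by_cases h1 : i.1 <:+ j.1
  · obtain ⟨a, ha, h⟩ := strict i j h1 huv
    exact ⟨a, 0, ha, h⟩
  by_cases h2 : j.1 <:+ i.1
  · obtain ⟨a, -, h⟩ := strict j i h2 (Ne.symm huv)
    exact ⟨0, a, fun _ => Or.inl hz.symm, fun x => (h x).symm⟩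
  refine ⟨0, 0, fun _ => Or.inl hz.symm, fun x => ?_⟩
  by_cases hx : i.1 <:+ x.word
  · right
    refine zero fun hx' => ?_
    rcases List.suffix_or_suffix_of_suffix hx hx' with h | h
    · exact h1 h
    · exact h2 h
  · exact Or.inl (zero hx)

/-- The pieces `i` of this kind form the leg at `q`, which a geodesic from `q` to `r` traverses
first: as long as `z` has not finished the leg, it agrees with `q` in all other pieces. -/
theorem coord_eq_or_of_wedge {p q z r : TreeOfFlats s} (h : dist q z + dist z r = dist q r)
    {i j : List FlatLetter × Bool} (hi : p.coord i = r.coord i) (hi' : q.coord i ≠ r.coord i)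
    (hj : ¬ (p.coord j = r.coord j ∧ q.coord j ≠ r.coord j)) :
    z.coord i = r.coord i ∨ z.coord j = q.coord j := by
  by_cases hqr : q.coord j = r.coord j
  · right
    have := (dist_add_dist_iff q z r).1 h j
    rw [← hqr, dist_self] at this
    have h1 : dist (z.coord j) (q.coord j) = 0 :=
      le_antisymm (by linarith [dist_nonneg (x := q.coord j) (y := z.coord j)]) dist_nonneg
    exact dist_eq_zero.1 h1
  have hij : i ≠ j := by rintro rfl; exact hj ⟨hi, hi'⟩
  obtain ⟨a, b, -, hab⟩ := wedge (s := s) hij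
  have hp := hab p
  have hq := hab q
  have hr := hab r
  have hz := hab z
  grind

/-- The comparison inequality for a point `z` on a geodesic from `q` to `r` (Stewart's theorem is the
Euclidean case of equality). -/
theorem stewart (p q z r : TreeOfFlats s) (h : dist q z + dist z r = dist q r) :
    dist q r * dist p z ^ 2 + dist q z * dist z r * dist q r ≤
      dist z r * dist p q ^ 2 + dist q z * dist p r ^ 2 := by
  classical
  have hc := (dist_add_dist_iff q z r).1 h
  have h' : dist r z + dist z q = dist r q := by
    rw [dist_comm r z, dist_comm z q, dist_comm r q]; linarith
  have t1 := dist_triangle q p r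
  have t2 := dist_triangle p q r
  have t3 := dist_triangle p r q
  have t4 := dist_comm q p
  have t5 := dist_comm q r
  -- Here `z` is still in the leg at `q`. Then it lies between `p` and `q`, and the inequality
  -- reduces to `|d(q,r) - d(p,q)| ≤ d(p,r)`. The next case is the leg at `r`.
  by_cases h1 : ∃ i, (p.coord i = r.coord i ∧ q.coord i ≠ r.coord i) ∧ z.coord i ≠ r.coord i
  · obtain ⟨i, ⟨hi, hi'⟩, hz⟩ := h1
    have hb : dist p z + dist z q = dist p q := by
      refine (dist_add_dist_iff p z q).2 fun j => ?_
      by_cases hj : p.coord j = r.coord j ∧ q.coord j ≠ r.coord j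
      · rw [hj.1]; exact (dist_add_dist_iff r z q).1 h' j
      · rw [(coord_eq_or_of_wedge h hi hi' hj).resolve_left hz]; simp
    have hb' : dist p z = dist p q - dist q z := by rw [dist_comm q z]; linarith
    rw [hb', ← h]
    have h2 : (dist q r - dist p q) ^ 2 ≤ dist p r ^ 2 :=
      sq_le_sq' (by linarith) (by linarith)
    have h3 := mul_le_mul_of_nonneg_left h2 (dist_nonneg (x := q) (y := z))
    rw [← h] at h3
    nlinarith
  by_cases h2 : ∃ i, (p.coord i = q.coord i ∧ r.coord i ≠ q.coord i) ∧ z.coord i ≠ q.coord i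
  · obtain ⟨i, ⟨hi, hi'⟩, hz⟩ := h2
    have hb : dist p z + dist z r = dist p r := by
      refine (dist_add_dist_iff p z r).2 fun j => ?_
      by_cases hj : p.coord j = q.coord j ∧ r.coord j ≠ q.coord j
      · rw [hj.1]; exact (dist_add_dist_iff q z r).1 h j
      · rw [(coord_eq_or_of_wedge h' hi hi' hj).resolve_left hz]; simp
    have hb' : dist p z = dist p r - dist z r := by linarith
    rw [hb', ← h]
    have h2 : (dist q r - dist p r) ^ 2 ≤ dist p q ^ 2 :=
      sq_le_sq' (by linarith) (by linarith)
    have h3 := mul_le_mul_of_nonneg_left h2 (dist_nonneg (x := z) (y := r))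
    rw [← h] at h3
    nlinarith
  push Not at h1 h2
  -- At most one piece sees three distinct projections: if `k` does, at most one of the three points
  -- has the wedge value in `k`, so the other two agree in every other piece. Without such a piece,
  -- any `k` serves.
  obtain ⟨k, hk⟩ : ∃ k, ∀ i ≠ k, p.coord i = q.coord i ∨ p.coord i = r.coord i ∨
      q.coord i = r.coord i := by
    by_cases hk : ∃ k, ¬ (p.coord k = q.coord k ∨ p.coord k = r.coord k ∨ q.coord k = r.coord k)
    · obtain ⟨k, hk⟩ := hk
      refine ⟨k, fun i hi => ?_⟩
      obtain ⟨a, b, -, hab⟩ := wedge (s := s) hi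
      have := hab p; have := hab q; have := hab r
      grind
    · push Not at hk
      exact ⟨([], true), fun i _ => hk i⟩
  obtain ⟨T1, s1⟩ := exists_support p q
  obtain ⟨T2, s2⟩ := exists_support p r
  obtain ⟨T3, s3⟩ := exists_support q r
  obtain ⟨T4, s4⟩ := exists_support p z
  obtain ⟨T5, s5⟩ := exists_support q z
  obtain ⟨T6, s6⟩ := exists_support z r
  set T := (T1 ∪ T2 ∪ T3 ∪ T4 ∪ T5 ∪ T6).erase k with hT
  have hkT : k ∉ T := Finset.notMem_erase k _
  have split : ∀ x y : TreeOfFlats s, (∀ i, x.coord i ≠ y.coord i → i ∈ insert k T) →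
      dist x y = dist (x.coord k) (y.coord k) + ∑ i ∈ T, dist (x.coord i) (y.coord i) :=
    fun x y hxy => by rw [dist_eq_sum_coord x y hxy, Finset.sum_insert hkT]
  -- `A`, `B` and `C` are the lengths outside `k` of the legs at `p`, `q` and `r`.
  set A := ∑ i ∈ T, if q.coord i = r.coord i then dist (p.coord i) (q.coord i) else 0
  set B := ∑ i ∈ T, if p.coord i = r.coord i then dist (q.coord i) (r.coord i) else 0
  set C := ∑ i ∈ T, if p.coord i = r.coord i then 0 else dist (q.coord i) (r.coord i)
  have hA : 0 ≤ A := Finset.sum_nonneg fun i _ => by split_ifs <;> positivity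
  have hB : 0 ≤ B := Finset.sum_nonneg fun i _ => by split_ifs <;> positivity
  have hC : 0 ≤ C := Finset.sum_nonneg fun i _ => by split_ifs <;> positivity
  have hzi : ∀ i, q.coord i = r.coord i → z.coord i = r.coord i := fun i hi => by
    have := hc i
    rw [hi, dist_self] at this
    exact dist_eq_zero.1 (le_antisymm
      (by linarith [dist_nonneg (x := r.coord i) (y := z.coord i)]) dist_nonneg)
  have hmem : ∀ i ∈ T, i ≠ k := fun i hi => Finset.ne_of_mem_erase hi
  have epq : dist p q = dist (p.coord k) (q.coord k) + (A + B) := by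
    rw [split p q (by grind), ← Finset.sum_add_distrib]
    congr 1
    refine Finset.sum_congr rfl fun i hi => ?_
    by_cases hqr : q.coord i = r.coord i
    · simp [hqr]
    · by_cases hpr : p.coord i = r.coord i
      · rw [if_neg hqr, if_pos hpr, hpr, zero_add, dist_comm]
      · rw [if_neg hqr, if_neg hpr, ((hk i (hmem i hi)).resolve_right (by tauto)), dist_self,
          add_zero]
  have epr : dist p r = dist (p.coord k) (r.coord k) + (A + C) := by
    rw [split p r (by grind), ← Finset.sum_add_distrib]
    congr 1
    refine Finset.sum_congr rfl fun i hi => ?_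
    by_cases hqr : q.coord i = r.coord i
    · simp [hqr]
    · by_cases hpr : p.coord i = r.coord i
      · rw [if_neg hqr, if_pos hpr, hpr, dist_self, add_zero]
      · rw [if_neg hqr, if_neg hpr, ((hk i (hmem i hi)).resolve_right (by tauto)), zero_add]
  have epz : dist p z = dist (p.coord k) (z.coord k) + A := by
    rw [split p z (by grind)]
    congr 1
    refine Finset.sum_congr rfl fun i hi => ?_
    have := hk i (hmem i hi)
    have e1 := h1 i
    have e2 := h2 i
    have e3 := hzi i
    split_ifs with hqr
    · rw [e3 hqr, hqr]
    · rcases this with h | h | h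
      · rw [e2 ⟨h, Ne.symm hqr⟩, h, dist_self]
      · rw [e1 ⟨h, hqr⟩, h, dist_self]
      · exact absurd h hqr
  have eqz : dist q z = dist (q.coord k) (z.coord k) + B := by
    rw [split q z (by grind)]
    congr 1
    refine Finset.sum_congr rfl fun i hi => ?_
    have := hk i (hmem i hi)
    have e1 := h1 i
    have e2 := h2 i
    have e3 := hzi i
    by_cases hqr : q.coord i = r.coord i
    · rw [e3 hqr, hqr]; simp
    · split_ifs with hpr
      · rw [e1 ⟨hpr, hqr⟩]
      · rw [e2 ⟨by tauto, Ne.symm hqr⟩, dist_self]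
  have ezr : dist z r = dist (z.coord k) (r.coord k) + C := by
    rw [split z r (by grind)]
    congr 1
    refine Finset.sum_congr rfl fun i hi => ?_
    have := hk i (hmem i hi)
    have e1 := h1 i
    have e2 := h2 i
    have e3 := hzi i
    by_cases hqr : q.coord i = r.coord i
    · rw [e3 hqr, hqr]; simp
    · split_ifs with hpr
      · rw [e1 ⟨hpr, hqr⟩, dist_self]
      · rw [e2 ⟨by tauto, Ne.symm hqr⟩]
  rw [← h, epq, epr, epz, eqz, ezr]
  have hE := (stewart_euclidean (p.coord k) (q.coord k) (z.coord k) (r.coord k) (hc k)).le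
  rw [← hc k] at hE
  have tri1 := dist_triangle (p.coord k) (z.coord k) (r.coord k)
  have tri2 := dist_triangle (p.coord k) (r.coord k) (z.coord k)
  have tri3 := dist_triangle (z.coord k) (p.coord k) (r.coord k)
  have tri4 := dist_triangle (p.coord k) (z.coord k) (q.coord k)
  have tri5 := dist_triangle (p.coord k) (q.coord k) (z.coord k)
  have tri6 := dist_triangle (q.coord k) (p.coord k) (z.coord k)
  have tri7 := dist_triangle (p.coord k) (q.coord k) (r.coord k)
  have tri8 := dist_triangle (p.coord k) (r.coord k) (q.coord k)
  have c1 := hc k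
  rw [dist_comm (r.coord k) (z.coord k)] at tri2
  rw [dist_comm (z.coord k) (p.coord k)] at tri3
  rw [dist_comm (z.coord k) (q.coord k)] at tri4
  rw [dist_comm (q.coord k) (p.coord k)] at tri6
  rw [dist_comm (r.coord k) (q.coord k)] at tri8
  rw [← c1] at tri7 tri8
  revert hE tri1 tri2 tri3 tri4 tri5 tri6 tri7 tri8
  have n1 := dist_nonneg (x := p.coord k) (y := q.coord k)
  have n2 := dist_nonneg (x := p.coord k) (y := r.coord k)
  have n3 := dist_nonneg (x := p.coord k) (y := z.coord k)
  have n4 := dist_nonneg (x := q.coord k) (y := z.coord k)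
  have n5 := dist_nonneg (x := z.coord k) (y := r.coord k)
  revert n1 n2 n3 n4 n5
  generalize dist (p.coord k) (q.coord k) = P
  generalize dist (p.coord k) (r.coord k) = R
  generalize dist (p.coord k) (z.coord k) = g
  generalize dist (q.coord k) (z.coord k) = α
  generalize dist (z.coord k) (r.coord k) = β
  intro n1 n2 n3 n4 n5 hE tri1 tri2 tri3 tri4 tri5 tri6 tri7 tri8
  -- The Euclidean triangle in `k` is lengthened at `q`, then at `r` with the roles of the two ends
  -- exchanged, then at `p`.
  have f1 := stewart_leg n4 n5 n3 n1 hB n2 hE tri1 (by linarith) (by linarith)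
  have f2 := stewart_leg (α := β) (β := α + B) (P := R) (R := P + B) (g := g) (B := C) n5
    (by linarith) n3 n2 hC (by linarith) (by linarith) (by linarith) (by linarith) (by linarith)
  have f3 := stewart_stem (α := α + B) (β := β + C) (P := P + B) (R := R + C) (g := g) (A := A)
    (by linarith) (by linarith) (by linarith) hA (by linarith) (by linarith) (by linarith)
    (by linarith)
  calc _ = (α + B + (β + C)) * (g + A) ^ 2 + (α + B) * (β + C) * (α + B + (β + C)) := by ring
    _ ≤ _ := f3
    _ = _ := by ring

end TreeOfFlats

/-! ### Geodesics and the CAT(0) inequality -/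

theorem IsReducedWord.of_suffix {u w : List FlatLetter} (hw : IsReducedWord w) (h : u <:+ w) :
    IsReducedWord u := List.IsChain.suffix hw h

namespace TreeOfFlats

variable {s : ℕ → ℝ}

/-- The lattice point that a letter points to in a flat of height `n`. -/
noncomputable def latticePoint (s : ℕ → ℝ) (n : ℕ) (v : ℤ × ℤ) : Plane :=
  s n • !₂[(v.1 : ℝ), (v.2 : ℝ)]

/-- The point of the flat `u` with Euclidean coordinates `v`. -/
def flatPoint (s : ℕ → ℝ) (u : List FlatLetter) (hu : IsReducedWord u) (v : Plane) :
    TreeOfFlats s :=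
  ⟨u, hu, v, 1, one_pos, le_rfl, fun h => absurd h (lt_irrefl 1)⟩

/-- The point at distance `τ` from the preceding flat on the edge leading to the flat `u`. -/
def edgePoint (s : ℕ → ℝ) (u : List FlatLetter) (hu : IsReducedWord u) (hne : u ≠ []) (τ : ℝ)
    (h0 : 0 < τ) (h1 : τ ≤ 1) : TreeOfFlats s :=
  ⟨u, hu, 0, τ, h0, h1, fun _ => ⟨hne, rfl⟩⟩

theorem edgeCoord_word (x : TreeOfFlats s) : x.edgeCoord x.word = x.t := by
  rw [edgeCoord, if_pos rfl]

theorem coord_eq_of_word_eq {x y : TreeOfFlats s} (h : x.word = y.word)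
    {i : List FlatLetter × Bool} (hi : i.1 ≠ x.word) : x.coord i = y.coord i := by
  obtain ⟨u, e⟩ := i
  cases e
  · rw [coord_false, coord_false, edgeCoord, edgeCoord, ← h, if_neg (Ne.symm hi)]
    rw [if_neg (Ne.symm hi)]
  · rw [coord_true, coord_true, flatCoord, flatCoord, ← h, if_neg (Ne.symm hi),
      if_neg (Ne.symm hi)]

theorem dist_of_coord_eq {x y : TreeOfFlats s} {u : List FlatLetter}
    (h : ∀ i : List FlatLetter × Bool, i.1 ≠ u → x.coord i = y.coord i) :
    dist x y = dist (x.flatCoord u) (y.flatCoord u) + |x.edgeCoord u - y.edgeCoord u| := by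
  rw [dist_eq_sum_coord (T := {(u, true), (u, false)}) x y, Finset.sum_pair (by simp),
    dist_coord_false, coord_true, coord_true]
  rintro ⟨v, e⟩ hi
  have : v = u := by
    by_contra hv
    exact hi (h (v, e) hv)
  subst this
  cases e <;> simp

theorem dist_of_word_eq {x y : TreeOfFlats s} (h : x.word = y.word) :
    dist x y = dist x.pos y.pos + |x.t - y.t| := by
  rw [dist_of_coord_eq (u := x.word) fun i hi => coord_eq_of_word_eq h hi]
  rw [flatCoord, flatCoord, edgeCoord, edgeCoord, if_pos rfl, if_pos rfl, if_pos h.symm,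
    if_pos h.symm]

/-- The vertex of the preceding flat from which the edge to the flat `a :: w` starts. -/
noncomputable def exitPoint (s : ℕ → ℝ) (a : FlatLetter) (w : List FlatLetter)
    (h : IsReducedWord (a :: w)) : TreeOfFlats s :=
  flatPoint s w (h.of_suffix (List.suffix_cons a w)) (latticePoint s w.length a.1)

theorem flatCoord_of_word {x : TreeOfFlats s} {w : List FlatLetter} (h : x.word = w)
    (u : List FlatLetter) : x.flatCoord u = if w = u then x.pos else exitPos s u w := by
  rw [flatCoord, h]

theorem edgeCoord_of_word {x : TreeOfFlats s} {w : List FlatLetter} (h : x.word = w)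
    (u : List FlatLetter) : x.edgeCoord u = if w = u then x.t else if u <:+ w then 1 else 0 := by
  rw [edgeCoord, h]

theorem dist_flatPoint {x : TreeOfFlats s} {u : List FlatLetter} (h : x.word = u)
    (hu : IsReducedWord u) (v : Plane) : dist x (flatPoint s u hu v) = dist x.pos v + |x.t - 1| :=
  dist_of_word_eq (y := flatPoint s u hu v) h

theorem dist_edgePoint {x : TreeOfFlats s} {u : List FlatLetter} (h : x.word = u)
    (hu : IsReducedWord u) (hne : u ≠ []) {τ : ℝ} (h0 : 0 < τ) (h1 : τ ≤ 1) :
    dist x (edgePoint s u hu hne τ h0 h1) = dist x.pos 0 + |x.t - τ| :=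
  dist_of_word_eq (y := edgePoint s u hu hne τ h0 h1) h

theorem coord_exitPoint {x : TreeOfFlats s} {a : FlatLetter} {w : List FlatLetter}
    (h : x.word = a :: w) {i : List FlatLetter × Bool} (hi : i.1 ≠ a :: w) :
    x.coord i = (exitPoint s a w (h ▸ x.reduced)).coord i := by
  obtain ⟨u, e⟩ := i
  have hi' : ¬ a :: w = u := Ne.symm hi
  have hw : (exitPoint s a w (h ▸ x.reduced)).word = w := rfl
  cases e
  · rw [coord_false, coord_false, edgeCoord_of_word h, edgeCoord_of_word hw, if_neg hi']
    by_cases hu : w = u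
    · subst hu
      simp [exitPoint, flatPoint]
    · have : (u <:+ a :: w) ↔ u <:+ w := by
        rw [List.suffix_cons_iff]; exact or_iff_right hi
      simp [hu, this]
  · rw [coord_true, coord_true, flatCoord_of_word h, flatCoord_of_word hw, if_neg hi', exitPos]
    by_cases hu : w = u
    · subst hu
      simp [exitPoint, flatPoint, latticePoint]
    · simp [hu]

theorem not_cons_suffix {a : FlatLetter} {w : List FlatLetter} : ¬ a :: w <:+ w := fun h => by
  simpa using h.length_le

theorem flatCoord_exitPoint {a : FlatLetter} {w : List FlatLetter}
    (h : IsReducedWord (a :: w)) : (exitPoint s a w h).flatCoord (a :: w) = 0 :=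
  flatCoord_eq_zero (x := exitPoint s a w h) (not_cons_suffix (a := a) (w := w))

theorem edgeCoord_exitPoint {a : FlatLetter} {w : List FlatLetter}
    (h : IsReducedWord (a :: w)) : (exitPoint s a w h).edgeCoord (a :: w) = 0 :=
  edgeCoord_eq_zero (x := exitPoint s a w h) (not_cons_suffix (a := a) (w := w))

theorem dist_exitPoint {x : TreeOfFlats s} {a : FlatLetter} {w : List FlatLetter}
    (h : x.word = a :: w) : dist x (exitPoint s a w (h ▸ x.reduced)) = ‖x.pos‖ + x.t := by
  rw [dist_of_coord_eq (u := a :: w) fun i hi => coord_exitPoint h hi,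
    flatCoord_exitPoint, edgeCoord_exitPoint, flatCoord, edgeCoord,
    if_pos h, if_pos h, dist_zero_right, sub_zero, abs_of_pos x.t_pos]

theorem dist_exitPoint_add {x y : TreeOfFlats s} {a : FlatLetter} {w : List FlatLetter}
    (h : x.word = a :: w) (hy : ¬ x.word <:+ y.word) :
    dist x y = ‖x.pos‖ + x.t + dist (exitPoint s a w (h ▸ x.reduced)) y := by
  rw [← dist_exitPoint h, eq_comm]
  refine dist_add_dist_of_coord ?_
  rintro ⟨u, e⟩
  by_cases hu : u = a :: w
  · right
    subst hu
    rw [h] at hy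
    cases e
    · rw [coord_false, coord_false, edgeCoord_eq_zero hy, edgeCoord_exitPoint]
    · rw [coord_true, coord_true, flatCoord_eq_zero hy, flatCoord_exitPoint]
  · left
    exact (coord_exitPoint h hu).symm

/-- Between `x` and `y` there are points at all distances from `x`. -/
def IsConnectable (x y : TreeOfFlats s) : Prop :=
  ∀ t, 0 ≤ t → t ≤ dist x y → ∃ z, dist x z = t ∧ dist z y = dist x y - t

theorem IsConnectable.symm {x y : TreeOfFlats s} (h : IsConnectable x y) : IsConnectable y x := by
  intro t h0 h1
  rw [dist_comm] at h1
  obtain ⟨z, h2, h3⟩ := h (dist x y - t) (by linarith) (by linarith)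
  exact ⟨z, by rw [dist_comm, h3]; ring, by rw [dist_comm, h2, dist_comm]⟩

theorem IsConnectable.trans {x m y : TreeOfFlats s} (h1 : IsConnectable x m)
    (h2 : IsConnectable m y) (h : dist x m + dist m y = dist x y) : IsConnectable x y := by
  intro t ht ht'
  rcases le_total t (dist x m) with hm | hm
  · obtain ⟨z, e1, e2⟩ := h1 t ht hm
    refine ⟨z, e1, le_antisymm ?_ ?_⟩
    · linarith [dist_triangle z m y]
    · linarith [dist_triangle x z y]
  · obtain ⟨z, e1, e2⟩ := h2 (t - dist x m) (by linarith) (by linarith)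
    have e3 : dist z y = dist x y - t := by linarith
    refine ⟨z, le_antisymm ?_ ?_, e3⟩
    · linarith [dist_triangle x m z]
    · linarith [dist_triangle x z y]

theorem isConnectable_flat {x y : TreeOfFlats s} (h : x.word = y.word) (hx : x.t = 1)
    (hy : y.t = 1) : IsConnectable x y := by
  intro t h0 h1
  have hd : dist x y = dist x.pos y.pos := by rw [dist_of_word_eq h, hx, hy]; simp
  rw [hd] at h1
  rcases h0.eq_or_lt with rfl | h0
  · exact ⟨x, by simp, by simp⟩
  have hpos : 0 < dist x.pos y.pos := h0.trans_le h1
  refine ⟨flatPoint s x.word x.reduced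
    (AffineMap.lineMap x.pos y.pos (t / dist x.pos y.pos)), ?_, ?_⟩
  · rw [dist_flatPoint rfl, hx]
    simp only [sub_self, abs_zero, add_zero]
    rw [dist_left_lineMap, Real.norm_of_nonneg (by positivity)]
    field_simp
  · rw [dist_comm, dist_flatPoint h.symm, hy, hd]
    simp only [sub_self, abs_zero, add_zero]
    rw [dist_comm, dist_lineMap_right, Real.norm_of_nonneg (by rw [sub_nonneg, div_le_one hpos]; exact h1)]
    field_simp

theorem isConnectable_edge {x y : TreeOfFlats s} (h : x.word = y.word) (hx : x.pos = 0)
    (hy : y.pos = 0) : IsConnectable x y := by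
  wlog hxy : x.t ≤ y.t generalizing x y
  · exact (this h.symm hy hx (le_of_not_ge hxy)).symm
  intro t h0 h1
  have hd : dist x y = y.t - x.t := by
    rw [dist_of_word_eq h, hx, hy, dist_self, zero_add, abs_sub_comm, abs_of_nonneg (by linarith)]
  rcases h1.eq_or_lt with rfl | h1
  · exact ⟨y, rfl, by simp⟩
  rw [hd] at h1
  have := y.t_le_one
  have := x.t_pos
  refine ⟨edgePoint s x.word x.reduced (x.of_t_lt_one (by linarith)).1 (x.t + t) (by linarith)
    (by linarith), ?_, ?_⟩
  · rw [dist_edgePoint rfl, hx]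
    simp [abs_of_nonneg h0]
  · rw [dist_comm, dist_edgePoint h.symm, hy, hd]
    simp only [dist_self, zero_add]
    rw [abs_of_nonneg (by linarith)]
    ring

theorem isConnectable_of_word_eq {x y : TreeOfFlats s} (h : x.word = y.word) :
    IsConnectable x y := by
  wlog hxy : x.t ≤ y.t generalizing x y
  · exact (this h.symm (le_of_not_ge hxy)).symm
  by_cases hx : x.t = 1
  · exact isConnectable_flat h hx (le_antisymm y.t_le_one (hx ▸ hxy))
  have hx0 := (x.of_t_lt_one (lt_of_le_of_ne x.t_le_one hx)).2
  by_cases hy : y.t = 1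
  · refine IsConnectable.trans (m := flatPoint s x.word x.reduced 0)
      (isConnectable_edge rfl hx0 rfl) (isConnectable_flat h rfl hy) ?_
    rw [dist_flatPoint rfl, dist_comm _ y, dist_flatPoint h.symm, dist_of_word_eq h, hy, hx0]
    simp [add_comm]
  · exact isConnectable_edge h hx0 (y.of_t_lt_one (lt_of_le_of_ne y.t_le_one hy)).2

theorem isConnectable_exitPoint {x : TreeOfFlats s} {a : FlatLetter} {w : List FlatLetter}
    (h : x.word = a :: w) : IsConnectable x (exitPoint s a w (h ▸ x.reduced)) := by
  have edge : ∀ {y : TreeOfFlats s} (h : y.word = a :: w), y.pos = 0 →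
      IsConnectable y (exitPoint s a w (h ▸ y.reduced)) := by
    intro y h hy t h0 h1
    rcases h1.eq_or_lt with rfl | h1
    · exact ⟨_, rfl, by simp⟩
    have hd := dist_exitPoint h
    rw [hy, norm_zero, zero_add] at hd
    rw [hd] at h1 ⊢
    have := y.t_le_one
    set z := edgePoint s y.word y.reduced (by simp [h]) (y.t - t) (by linarith) (by linarith)
    have hz : z.word = a :: w := h
    refine ⟨z, ?_, ?_⟩
    · rw [dist_edgePoint rfl, hy]
      simp [abs_of_nonneg h0]
    · exact (dist_exitPoint hz).trans (by simp [z, edgePoint])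
  rcases x.t_le_one.lt_or_eq with ht | ht
  · exact edge h (x.of_t_lt_one ht).2
  · set m := flatPoint s x.word x.reduced 0 with hm
    have hmw : m.word = a :: w := h
    refine IsConnectable.trans (m := m) (isConnectable_flat rfl ht rfl) (edge hmw rfl) ?_
    rw [dist_exitPoint h, dist_exitPoint hmw, hm, dist_flatPoint rfl, ht]
    simp [flatPoint]

/-- Induction on the total length of the words: if the flat of `x` is not on the way to `y`, every
path to `y` passes through the exit point in the preceding flat, whose word is shorter. -/
theorem isConnectable (x y : TreeOfFlats s) : IsConnectable x y := by
  suffices H : ∀ n, ∀ x y : TreeOfFlats s, x.word.length + y.word.length = n →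
      IsConnectable x y from H _ x y rfl
  intro n
  induction n using Nat.strong_induction_on with
  | _ n ih =>
    have main : ∀ x y : TreeOfFlats s, x.word.length + y.word.length = n →
        ¬ x.word <:+ y.word → IsConnectable x y := by
      intro x y hn hxy
      rcases h : x.word with _ | ⟨a, w⟩
      · exact absurd (h ▸ List.nil_suffix) hxy
      · refine (isConnectable_exitPoint h).trans (ih (w.length + y.word.length) ?_ _ _ rfl) ?_
        · rw [← hn, h]; simp
        · rw [dist_exitPoint h, ← dist_exitPoint_add h hxy]
    intro x y hn
    by_cases h1 : x.word <:+ y.word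
    · by_cases h2 : y.word <:+ x.word
      · exact isConnectable_of_word_eq (h1.eq_of_length_le h2.length_le)
      · exact (main y x (by omega) h2).symm
    · exact main x y hn h1

/-- Points of a geodesic are determined by their distances from the ends. -/
theorem eq_of_between {q r z z' : TreeOfFlats s} (h : dist q z + dist z r = dist q r)
    (h1 : dist q z' = dist q z) (h2 : dist z' r = dist z r) : z' = z := by
  have := stewart z' q z r h
  rw [dist_comm z' q, h1, h2] at this
  rcases (dist_nonneg (x := q) (y := r)).eq_or_lt with h0 | h0
  · have n1 := dist_nonneg (x := q) (y := z)
    have n2 := dist_nonneg (x := z) (y := r)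
    have e1 : dist q z = 0 := by linarith
    rw [e1] at h1
    rw [← dist_eq_zero.1 e1, ← dist_eq_zero.1 h1]
  · have h3 : dist q r * dist z' z ^ 2 ≤ 0 := by
      have : dist q r * dist z' z ^ 2 ≤ dist q z * dist z r * (dist q z + dist z r - dist q r) := by
        nlinarith
      rw [h] at this
      simpa using this
    have h4 : dist z' z ^ 2 = 0 :=
      le_antisymm (nonpos_of_mul_nonpos_right h3 h0) (sq_nonneg _)
    exact dist_eq_zero.1 (pow_eq_zero_iff two_ne_zero |>.1 h4)

/-- By uniqueness, a point between `q` and `z'` at the same distance from `q` as `z` must be `z`, so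
`z` and `z'` lie on one geodesic. -/
theorem dist_of_between {q r z z' : TreeOfFlats s} (h : dist q z + dist z r = dist q r)
    (h' : dist q z' + dist z' r = dist q r) : dist z z' = |dist q z - dist q z'| := by
  wlog hle : dist q z ≤ dist q z' generalizing z z'
  · rw [dist_comm, abs_sub_comm]; exact this h' h (le_of_not_ge hle)
  obtain ⟨w, h1, h2⟩ := isConnectable q z' (dist q z) dist_nonneg hle
  have h3 : dist w r = dist z r := by
    apply le_antisymm
    · linarith [dist_triangle w z' r]
    · linarith [dist_triangle q w r]
  rw [← eq_of_between h h1 h3, abs_sub_comm, h1, h2, abs_of_nonneg (by linarith)]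

theorem exists_geodesicSegment (p q : TreeOfFlats s) : ∃ γ : ℝ → TreeOfFlats s,
    IsGeodesicSegment γ p q := by
  have hc : ∀ t : ℝ, ∃ z : TreeOfFlats s, 0 ≤ t → t ≤ dist p q →
      dist p z = t ∧ dist z q = dist p q - t := fun t => by
    by_cases h : 0 ≤ t ∧ t ≤ dist p q
    · obtain ⟨z, hz⟩ := isConnectable p q t h.1 h.2
      exact ⟨z, fun _ _ => hz⟩
    · exact ⟨p, fun h1 h2 => absurd ⟨h1, h2⟩ h⟩
  choose γ h using hc
  have h1 := fun t h0 h1 => (h t h0 h1).1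
  have h2 := fun t h0 h1 => (h t h0 h1).2
  refine ⟨γ, ?_, ?_, ?_⟩
  · exact (dist_eq_zero.1 (h1 0 le_rfl dist_nonneg)).symm
  · exact dist_eq_zero.1 ((h2 _ dist_nonneg le_rfl).trans (sub_self _))
  · intro a ha b hb
    rw [dist_of_between (q := p) (r := q), h1 a ha.1 ha.2, h1 b hb.1 hb.2]
    · rw [h1 a ha.1 ha.2, h2 a ha.1 ha.2]; ring
    · rw [h1 b hb.1 hb.2, h2 b hb.1 hb.2]; ring

end TreeOfFlats

theorem IsGeodesicSegment.dist_left {X : Type*} [MetricSpace X] {γ : ℝ → X} {p q : X}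
    (h : IsGeodesicSegment γ p q) {a : ℝ} (ha : a ∈ Icc 0 (dist p q)) : dist p (γ a) = a := by
  conv_lhs => rw [← h.1]
  rw [h.2.2 0 ⟨le_rfl, dist_nonneg⟩ a ha, zero_sub, abs_neg, abs_of_nonneg ha.1]

theorem IsGeodesicSegment.dist_right {X : Type*} [MetricSpace X] {γ : ℝ → X} {p q : X}
    (h : IsGeodesicSegment γ p q) {a : ℝ} (ha : a ∈ Icc 0 (dist p q)) :
    dist (γ a) q = dist p q - a := by
  conv_lhs => rw [← h.2.1]
  rw [h.2.2 a ha _ ⟨dist_nonneg, le_rfl⟩, abs_sub_comm, abs_of_nonneg (sub_nonneg.2 ha.2)]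

namespace TreeOfFlats

variable {s : ℕ → ℝ}

/-- Stewart's inequality is used for the apex `y` over `x ∈ [p,q]` and for the apex `q` over `y ∈
[p,r]`. In the plane both are equalities. The cases `p = q` and `p = r` are split off because the
factors `d(p,q)` and `d(p,r)` are cancelled at the end. -/
theorem isCAT0 : IsCAT0 (TreeOfFlats s) := by
  refine ⟨exists_geodesicSegment, ?_⟩
  intro p q r γ δ hγ hδ p' q' r' e1 e2 e3 a ha b hb x' hx' y' hy' fa fb
  have gx1 := hγ.dist_left ha
  have gx2 := hγ.dist_right ha
  have gy1 := hδ.dist_left hb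
  have gy2 := hδ.dist_right hb
  set x := γ a
  set y := δ b
  have hx1 : dist p' x' + dist x' q' = dist p' q' := dist_add_dist_of_mem_segment hx'
  have hy1 : dist p' y' + dist y' r' = dist p' r' := dist_add_dist_of_mem_segment hy'
  have fx : dist x' q' = dist p q - a := by linarith
  have fy : dist y' r' = dist p r - b := by linarith
  rcases (dist_nonneg (x := p) (y := q)).eq_or_lt with h0 | hpq
  · have ha0 : a = 0 := le_antisymm (ha.2.trans_eq h0.symm) ha.1
    rw [ha0] at gx1 fa
    rw [← dist_eq_zero.1 gx1, ← dist_eq_zero.1 fa, gy1, fb]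
  rcases (dist_nonneg (x := p) (y := r)).eq_or_lt with h0 | hpr
  · have hb0 : b = 0 := le_antisymm (hb.2.trans_eq h0.symm) hb.1
    rw [hb0] at gy1 fb
    rw [← dist_eq_zero.1 gy1, ← dist_eq_zero.1 fb, dist_comm, gx1, dist_comm, fa]
  have s1 := stewart y p x q (by rw [gx1, gx2]; ring)
  have s2 := stewart q p y r (by rw [gy1, gy2]; ring)
  have t1 := stewart_euclidean y' p' x' q' hx1
  have t2 := stewart_euclidean q' p' y' r' hy1
  rw [gx1, gx2, dist_comm y x, dist_comm y p, dist_comm y q, gy1] at s1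
  rw [gy1, gy2, dist_comm q p] at s2
  rw [fa, fx, e1, dist_comm y' x', dist_comm y' p', dist_comm y' q', fb] at t1
  rw [fb, fy, e2, dist_comm q' p', e1, e3] at t2
  -- The weights `dist p r` and `a` eliminate `d(q,y)²` from the two inequalities.
  have key : dist p r * (dist p q * dist x y ^ 2) ≤ dist p r * (dist p q * dist x' y' ^ 2) := by
    have h1 := mul_le_mul_of_nonneg_left s1 hpr.le
    have h2 := mul_le_mul_of_nonneg_left s2 ha.1
    have h3 := congrArg (dist p r * ·) t1
    have h4 := congrArg (a * ·) t2
    nlinarith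
  have key2 := le_of_mul_le_mul_left (le_of_mul_le_mul_left key hpr) hpq
  exact (abs_le_of_sq_le_sq' key2 dist_nonneg).2

end TreeOfFlats

/-! ### Properness -/

theorem List.finite_length_le_of_forall_mem {α : Type*} {S : Set α} (hS : S.Finite) (n : ℕ) :
    {l : List α | l.length ≤ n ∧ ∀ a ∈ l, a ∈ S}.Finite := by
  have := hS.to_subtype
  refine ((List.finite_length_le S n).image (List.map Subtype.val)).subset ?_
  rintro l ⟨h1, h2⟩
  lift l to List S using h2
  exact ⟨l, by simpa using h1, rfl⟩

theorem finite_flatLetters (K : ℝ) :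
    {a : FlatLetter | |(a.1.1 : ℝ)| ≤ K ∧ |(a.1.2 : ℝ)| ≤ K}.Finite := by
  refine (((Set.finite_Icc (-⌈K⌉) ⌈K⌉).prod (Set.finite_Icc (-⌈K⌉) ⌈K⌉)).prod
    (Set.finite_univ (α := Bool))).subset ?_
  have aux : ∀ n : ℤ, |(n : ℝ)| ≤ K → n ∈ Icc (-⌈K⌉) ⌈K⌉ := by
    intro n hn
    obtain ⟨h1, h2⟩ := abs_le.1 (hn.trans (Int.le_ceil K))
    exact ⟨by exact_mod_cast h1, by exact_mod_cast h2⟩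
  rintro ⟨⟨i, j⟩, e⟩ ⟨h1, h2⟩
  exact ⟨⟨aux i h1, aux j h2⟩, mem_univ e⟩

theorem finite_words (n : ℕ) (K : ℝ) : {w : List FlatLetter | w.length ≤ n ∧
    ∀ a ∈ w, |(a.1.1 : ℝ)| ≤ K ∧ |(a.1.2 : ℝ)| ≤ K}.Finite :=
  List.finite_length_le_of_forall_mem (finite_flatLetters K) n

namespace TreeOfFlats

variable {s : ℕ → ℝ}

theorem norm_latticePoint (s : ℕ → ℝ) (n : ℕ) (v : ℤ × ℤ) :
    ‖latticePoint s n v‖ = |s n| * √((v.1 : ℝ) ^ 2 + (v.2 : ℝ) ^ 2) := by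
  rw [latticePoint, norm_smul, Real.norm_eq_abs, EuclideanSpace.norm_eq]
  simp

theorem le_norm_latticePoint {n : ℕ} (hs : 1 ≤ s n) (v : ℤ × ℤ) :
    |(v.1 : ℝ)| ≤ ‖latticePoint s n v‖ ∧ |(v.2 : ℝ)| ≤ ‖latticePoint s n v‖ := by
  rw [norm_latticePoint, abs_of_pos (zero_lt_one.trans_le hs)]
  have h : √((v.1 : ℝ) ^ 2 + (v.2 : ℝ) ^ 2) ≤ s n * √((v.1 : ℝ) ^ 2 + (v.2 : ℝ) ^ 2) :=
    le_mul_of_one_le_left (Real.sqrt_nonneg _) hs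
  refine ⟨(Real.abs_le_sqrt ?_).trans h, (Real.abs_le_sqrt ?_).trans h⟩
  · nlinarith [sq_nonneg (v.2 : ℝ)]
  · nlinarith [sq_nonneg (v.1 : ℝ)]

theorem scale_le_norm_latticePoint {n : ℕ} (hs : 0 ≤ s n) {v : ℤ × ℤ} (hv : v ≠ 0) :
    s n ≤ ‖latticePoint s n v‖ := by
  rw [norm_latticePoint, abs_of_nonneg hs]
  refine le_mul_of_one_le_right hs (Real.one_le_sqrt.2 ?_)
  have h : (1 : ℤ) ≤ v.1 ^ 2 + v.2 ^ 2 := by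
    by_contra h
    have h1 : v.1 ^ 2 = 0 := by nlinarith [sq_nonneg v.1, sq_nonneg v.2]
    have h2 : v.2 ^ 2 = 0 := by nlinarith [sq_nonneg v.1, sq_nonneg v.2]
    exact hv (Prod.ext (pow_eq_zero_iff two_ne_zero |>.1 h1) (pow_eq_zero_iff two_ne_zero |>.1 h2))
  exact_mod_cast h

theorem flatCoord_base (u : List FlatLetter) : (base s).flatCoord u = 0 := by
  rw [flatCoord_of_word (w := []) rfl]
  split_ifs <;> rfl

theorem edgeCoord_base {u : List FlatLetter} (hu : u ≠ []) : (base s).edgeCoord u = 0 :=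
  edgeCoord_eq_zero fun h => hu (List.suffix_nil.1 h)

theorem norm_flatCoord_le (x : TreeOfFlats s) (u : List FlatLetter) :
    ‖x.flatCoord u‖ ≤ dist x (base s) := by
  have := dist_coord_le x (base s) (u, true)
  rwa [coord_true, coord_true, flatCoord_base, dist_zero_right] at this

theorem norm_pos_le (x : TreeOfFlats s) : ‖x.pos‖ ≤ dist x (base s) := by
  simpa [flatCoord] using norm_flatCoord_le x x.word

theorem dist_base_of_word_nil {x : TreeOfFlats s} (h : x.word = []) :
    dist x (base s) = ‖x.pos‖ ∧ x.t = 1 := by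
  have ht : x.t = 1 := by
    by_contra ht
    exact (x.of_t_lt_one (lt_of_le_of_ne x.t_le_one ht)).1 h
  refine ⟨?_, ht⟩
  rw [dist_of_word_eq (y := base s) h, ht]
  simp [base]

theorem dist_base_of_word_cons {x : TreeOfFlats s} {a : FlatLetter} {w : List FlatLetter}
    (h : x.word = a :: w) :
    dist x (base s) = ‖x.pos‖ + x.t + dist (exitPoint s a w (h ▸ x.reduced)) (base s) := by
  refine dist_exitPoint_add h ?_
  rw [h]
  exact fun h => by simpa using List.suffix_nil.1 h

/-- Each letter costs an edge of length 1. The `1` on the right pays for `t = 1` in the flat `[]`,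
to which no edge leads. -/
theorem length_add_le_dist_base (x : TreeOfFlats s) :
    x.word.length + ‖x.pos‖ + x.t ≤ dist x (base s) + 1 := by
  induction h : x.word generalizing x with
  | nil =>
    obtain ⟨h1, h2⟩ := dist_base_of_word_nil h
    rw [h1, h2]; simp
  | cons a w ih =>
    rw [dist_base_of_word_cons h]
    have := ih (exitPoint s a w (h ▸ x.reduced)) rfl
    have h1 : (exitPoint s a w (h ▸ x.reduced)).t = 1 := rfl
    rw [h1] at this
    have := norm_nonneg (exitPoint s a w (h ▸ x.reduced)).pos
    push_cast [List.length_cons]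
    linarith

theorem letter_le_dist_base (hs : ∀ n, 1 ≤ s n) (x : TreeOfFlats s) :
    ∀ a ∈ x.word, |(a.1.1 : ℝ)| ≤ dist x (base s) ∧ |(a.1.2 : ℝ)| ≤ dist x (base s) := by
  induction h : x.word generalizing x with
  | nil => simp
  | cons a w ih =>
    have h1 : dist (exitPoint s a w (h ▸ x.reduced)) (base s) ≤ dist x (base s) := by
      rw [dist_base_of_word_cons h]
      linarith [norm_nonneg x.pos, x.t_pos]
    intro c hc
    rcases List.mem_cons.1 hc with rfl | hc
    · have h2 := (norm_pos_le (exitPoint s c w (h ▸ x.reduced))).trans h1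
      have h3 := le_norm_latticePoint (hs w.length) c.1
      exact ⟨h3.1.trans h2, h3.2.trans h2⟩
    · have h2 := ih (exitPoint s a w (h ▸ x.reduced)) rfl c hc
      exact ⟨h2.1.trans h1, h2.2.trans h1⟩

/-- The part of a ball in a flat and the edge leading to it is contained in a compact set. -/
theorem exists_compact_cell (w : List FlatLetter) (R : ℝ) : ∃ K : Set (TreeOfFlats s),
    IsCompact K ∧ ∀ x : TreeOfFlats s, x.word = w → dist x (base s) ≤ R → x ∈ K := by
  by_cases hw : IsReducedWord w
  swap
  · exact ⟨∅, isCompact_empty, fun x hx => absurd (hx ▸ x.reduced) hw⟩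
  have flat : IsCompact (flatPoint s w hw '' Metric.closedBall 0 R) := by
    refine (isCompact_closedBall _ _).image (Isometry.continuous ?_)
    refine Isometry.of_dist_eq fun v v' => ?_
    refine (dist_flatPoint (x := flatPoint s w hw v) (u := w) rfl hw v').trans ?_
    simp [flatPoint]
  have mem_flat : ∀ x : TreeOfFlats s, x.word = w → dist x (base s) ≤ R → x.t = 1 →
      x ∈ flatPoint s w hw '' Metric.closedBall 0 R := by
    intro x hx hR ht
    refine ⟨x.pos, mem_closedBall_zero_iff.2 ((norm_pos_le x).trans hR), ?_⟩
    subst hx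
    exact TreeOfFlats.ext rfl rfl ht.symm
  rcases w with _ | ⟨a, w⟩
  · exact ⟨_, flat, fun x hx hR => mem_flat x hx hR (dist_base_of_word_nil hx).2⟩
  -- The points indexed by the word have `t > 0`; the exit point of the preceding flat is added at
  -- `0` to close the edge.
  let ψ : ℝ → TreeOfFlats s := fun τ => if h : 0 < τ ∧ τ ≤ 1 then
    edgePoint s (a :: w) hw (List.cons_ne_nil a w) τ h.1 h.2 else exitPoint s a w hw
  have hψ : ∀ τ ∈ Icc (0 : ℝ) 1, ∀ τ' ∈ Icc (0 : ℝ) 1, dist (ψ τ) (ψ τ') = |τ - τ'| := by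
    have pos0 : ∀ τ (h0 : 0 < τ) (h1 : τ ≤ 1), dist (ψ τ) (ψ 0) = τ := by
      intro τ h0 h1
      simp only [ψ, dif_pos (And.intro h0 h1), lt_irrefl, false_and, dite_false]
      rw [dist_exitPoint rfl]
      simp [edgePoint]
    intro τ h τ' h'
    rcases h.1.eq_or_lt with rfl | h0 <;> rcases h'.1.eq_or_lt with rfl | h0'
    · simp
    · rw [dist_comm, pos0 _ h0' h'.2, zero_sub, abs_neg, abs_of_pos h0']
    · rw [pos0 _ h0 h.2, sub_zero, abs_of_pos h0]
    · simp only [ψ, dif_pos (And.intro h0 h.2), dif_pos (And.intro h0' h'.2)]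
      refine (dist_edgePoint (x := edgePoint s (a :: w) hw (List.cons_ne_nil a w) τ h0 h.2)
        (u := a :: w) rfl hw (List.cons_ne_nil a w) h0' h'.2).trans ?_
      simp [edgePoint]
  have edge : IsCompact (ψ '' Icc 0 1) := by
    refine isCompact_Icc.image_of_continuousOn (Metric.continuousOn_iff.2 fun τ h ε hε => ?_)
    exact ⟨ε, hε, fun τ' h' hd => by rwa [hψ τ' h' τ h, ← Real.dist_eq]⟩
  refine ⟨_, flat.union edge, fun x hx hR => ?_⟩
  rcases x.t_le_one.lt_or_eq with ht | ht
  · right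
    refine ⟨x.t, ⟨x.t_pos.le, x.t_le_one⟩, ?_⟩
    simp only [ψ, dif_pos (And.intro x.t_pos x.t_le_one)]
    exact TreeOfFlats.ext hx.symm (x.of_t_lt_one ht).2.symm rfl
  · exact Or.inl (mem_flat x hx hR ht)

/-- In a ball both the length of the words and the size of the letters are bounded, so finitely many
compact cells cover it. -/
theorem properSpace (hs : ∀ n, 1 ≤ s n) : ProperSpace (TreeOfFlats s) := by
  have key : ∀ R, IsCompact (Metric.closedBall (base s) R) := by
    intro R
    choose K hK hmem using fun w => exists_compact_cell (s := s) w R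
    refine IsCompact.of_isClosed_subset
      ((finite_words ⌊R + 1⌋₊ R).isCompact_biUnion fun w _ => hK w) Metric.isClosed_closedBall ?_
    intro x hx
    rw [Metric.mem_closedBall] at hx
    refine mem_biUnion (x := x.word) ⟨Nat.le_floor ?_, fun a ha => ?_⟩ (hmem _ x rfl hx)
    · linarith [length_add_le_dist_base x, norm_nonneg x.pos, x.t_pos]
    · exact ⟨((letter_le_dist_base hs x a ha).1).trans hx,
        ((letter_le_dist_base hs x a ha).2).trans hx⟩
  refine ⟨fun x r => (key (r + dist x (base s))).of_isClosed_subset Metric.isClosed_closedBall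
    (Metric.closedBall_subset_closedBall' le_rfl)⟩

/-! ### Points on geodesics from the base-point -/

/-- A geodesic from the base-point that crosses the flat `u` runs straight from the vertex where the
flat is entered. -/
theorem flat_between {x : TreeOfFlats s} {u : List FlatLetter} (hu : IsReducedWord u)
    (h : x.edgeCoord u = 1) {θ : ℝ} (h0 : 0 ≤ θ) (h1 : θ ≤ 1) :
    dist (base s) (flatPoint s u hu (θ • x.flatCoord u)) +
      dist (flatPoint s u hu (θ • x.flatCoord u)) x = dist (base s) x := by
  have hux : u <:+ x.word := by
    by_contra hn
    rw [edgeCoord_eq_zero hn] at h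
    exact zero_ne_one h
  set f := flatPoint s u hu (θ • x.flatCoord u) with hf
  have hfw : f.word = u := rfl
  refine (dist_add_dist_iff _ _ _).2 ?_
  rintro ⟨v, e⟩
  by_cases hvu : v <:+ u
  · by_cases hne : v = u
    · subst hne
      cases e
      · rw [coord_false f, coord_false x, h, edgeCoord_of_word hfw, if_pos rfl]
        simp [hf, flatPoint]
      · rw [coord_true, coord_true f, coord_true x, flatCoord_base, flatCoord_of_word hfw,
          if_pos rfl]
        simp only [hf, flatPoint, dist_eq_norm, zero_sub, norm_neg]
        rw [← norm_neg (θ • x.flatCoord v - _), show -(θ • x.flatCoord v - x.flatCoord v) =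
          (1 - θ) • x.flatCoord v by module, norm_smul, norm_smul, Real.norm_of_nonneg h0,
          Real.norm_of_nonneg (sub_nonneg.2 h1)]
        ring
    · have hfu : u <:+ f.word := hfw ▸ List.suffix_refl u
      cases e
      · rw [coord_false f, coord_false x, edgeCoord_of_suffix hvu hne hfu,
          edgeCoord_of_suffix hvu hne hux]
        simp
      · rw [coord_true f, coord_true x, flatCoord_of_suffix hvu hne hfu,
          flatCoord_of_suffix hvu hne hux]
        simp
  · have hv : v ≠ [] := by rintro rfl; exact hvu List.nil_suffix
    have hvf : ¬ v <:+ f.word := hvu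
    cases e
    · rw [coord_false f, coord_false (base s), edgeCoord_base hv, edgeCoord_eq_zero hvf]
      simp
    · rw [coord_true f, coord_true (base s), flatCoord_base, flatCoord_eq_zero hvf]
      simp

/-- The interior points of an edge separate its two sides. -/
theorem edge_between {x y : TreeOfFlats s} {u : List FlatLetter} (hu : IsReducedWord u)
    (hne : u ≠ []) {τ : ℝ} (h0 : 0 < τ) (h1 : τ < 1) (hx : x.edgeCoord u < τ)
    (hy : τ < y.edgeCoord u) :
    dist x (edgePoint s u hu hne τ h0 h1.le) + dist (edgePoint s u hu hne τ h0 h1.le) y =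
      dist x y := by
  set z := edgePoint s u hu hne τ h0 h1.le with hz
  have hzu : z.edgeCoord u = τ := edgeCoord_word z
  refine (dist_add_dist_iff _ _ _).2 fun j => ?_
  by_cases hj : (u, false) = j
  · subst hj
    rw [dist_coord_false, dist_coord_false, dist_coord_false, hzu, abs_sub_comm _ τ,
      abs_of_pos (by linarith), abs_sub_comm τ, abs_of_pos (by linarith), abs_sub_comm,
      abs_of_pos (by linarith)]
    ring
  obtain ⟨a, b, ha, hab⟩ := wedge (s := s) hj
  have inj : ∀ c d : ℝ, (EuclideanSpace.single 0 c : Plane) = EuclideanSpace.single 0 d → c = d :=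
    fun c d h => by simpa using congrArg (fun v : Plane => v 0) h
  have hzj : z.coord j = b := by
    refine (hab z).resolve_left fun h => ?_
    rw [coord_false, hzu] at h
    rcases ha rfl with ha | ha
    · exact h0.ne' (inj _ _ (h.trans ha))
    · exact h1.ne (inj _ _ (h.trans ha))
  rcases hab x with h | h
  · rcases hab y with h' | h'
    · have := inj _ _ (h.trans h'.symm)
      linarith
    · rw [hzj, h']; simp
  · rw [hzj, h]; simp

theorem suffix_of_between {z y : TreeOfFlats s}
    (h : dist (base s) z + dist z y = dist (base s) y) : z.word <:+ y.word := by
  by_contra hn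
  have hne : z.word ≠ [] := fun h => hn (h ▸ List.nil_suffix)
  have := (dist_add_dist_iff _ _ _).1 h (z.word, false)
  rw [dist_coord_false, dist_coord_false, dist_coord_false, edgeCoord_base hne, edgeCoord_word,
    edgeCoord_eq_zero hn, sub_zero, zero_sub, abs_neg, abs_of_pos z.t_pos] at this
  simp at this
  linarith [z.t_pos]

theorem flatCoord_of_cons_suffix {x : TreeOfFlats s} {a : FlatLetter} {w : List FlatLetter}
    (h : a :: w <:+ x.word) : x.flatCoord w = latticePoint s w.length a.1 := by
  rw [flatCoord_of_suffix (List.suffix_cons a w) (by simp) h, exitPos, if_pos rfl, latticePoint]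

/-- The geodesic crosses `x.word.length + 1` flats, each along a segment of length at most `M`, and
at most one edge per flat. Short segments thus force great height. -/
theorem dist_base_le {x : TreeOfFlats s} {M : ℝ} (hM : ∀ u, ‖x.flatCoord u‖ ≤ M) :
    dist x (base s) ≤ (x.word.length + 1) * (M + 1) := by
  induction h : x.word generalizing x with
  | nil =>
    obtain ⟨h1, h2⟩ := dist_base_of_word_nil h
    have := hM x.word
    rw [flatCoord, if_pos rfl] at this
    rw [h1]; simp; linarith
  | cons a w ih =>
    have h1 : ∀ u, ‖(exitPoint s a w (h ▸ x.reduced)).flatCoord u‖ ≤ M := by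
      intro u
      by_cases hu : u = a :: w
      · rw [hu, flatCoord_exitPoint, norm_zero]
        exact (norm_nonneg _).trans (hM [])
      · have := coord_exitPoint h (i := (u, true)) hu
        rw [coord_true, coord_true] at this
        rw [← this]
        exact hM u
    have h2 := ih h1 rfl
    have h3 := hM x.word
    rw [flatCoord, if_pos rfl] at h3
    have h4 := x.t_le_one
    rw [dist_base_of_word_cons h]
    push_cast [List.length_cons]
    linarith

end TreeOfFlats

/-! ### Geodesic rays, and how long segments prevent contraction -/

theorem GeodesicRay.ext {X : Type*} [MetricSpace X] {o : X} {b b' : GeodesicRay X o}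
    (h : ∀ t, b.toFun t = b'.toFun t) : b = b' := by
  cases b; cases b'
  congr
  exact funext h

theorem GeodesicRay.dist_eq {X : Type*} [MetricSpace X] {o : X} (b : GeodesicRay X o)
    (t t' : ℝ≥0) : dist (b.toFun t) (b.toFun t') = |(t : ℝ) - t'| := by
  rw [b.isometry.dist_eq, NNReal.dist_eq]

theorem GeodesicRay.dist_base {X : Type*} [MetricSpace X] {o : X} (b : GeodesicRay X o)
    (t : ℝ≥0) : dist o (b.toFun t) = t := by
  have h := b.dist_eq 0 t
  rw [b.map_zero] at h
  simpa using h

theorem GeodesicRay.dist_add {X : Type*} [MetricSpace X] {o : X} (b : GeodesicRay X o)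
    {t t' t'' : ℝ≥0} (h : t ≤ t') (h' : t' ≤ t'') :
    dist (b.toFun t) (b.toFun t') + dist (b.toFun t') (b.toFun t'') =
      dist (b.toFun t) (b.toFun t'') := by
  have h1 : (t : ℝ) ≤ t' := h
  have h2 : (t' : ℝ) ≤ t'' := h'
  simp only [b.dist_eq]
  rw [abs_sub_comm, abs_of_nonneg (by linarith), abs_sub_comm, abs_of_nonneg (by linarith),
    abs_sub_comm, abs_of_nonneg (by linarith)]
  ring

theorem mem_nearestPoints {X : Type*} [MetricSpace X] {Z : Set X} {x f : X} {d : ℝ} (hf : f ∈ Z)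
    (h : dist x f = d) (hd : ∀ z ∈ Z, d ≤ dist x z) :
    f ∈ nearestPoints Z x ∧ Metric.infDist x Z = d := by
  have : Metric.infDist x Z = d :=
    le_antisymm (h ▸ Metric.infDist_le_dist_of_mem hf) ((Metric.le_infDist ⟨f, hf⟩).2 fun _ hy => hd _ hy)
  exact ⟨⟨hf, h.trans this.symm⟩, this⟩

namespace TreeOfFlats

variable {s : ℕ → ℝ}

theorem eq_ray_of_between (b : GeodesicRay (TreeOfFlats s) (base s)) {z : TreeOfFlats s} {t : ℝ≥0}
    (h : dist (base s) z + dist z (b.toFun t) = dist (base s) (b.toFun t)) :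
    z = b.toFun (nndist (base s) z) := by
  have hz : dist (base s) z ≤ t := by
    rw [← b.dist_base t, ← h]; exact le_add_of_nonneg_right dist_nonneg
  refine (eq_of_between h (b.dist_base _) ?_).symm
  rw [b.dist_base] at h
  rw [b.dist_eq, coe_nndist, abs_sub_comm, abs_of_nonneg (by linarith)]
  linarith

theorem word_suffix (b : GeodesicRay (TreeOfFlats s) (base s)) {t t' : ℝ≥0} (h : t ≤ t') :
    (b.toFun t).word <:+ (b.toFun t').word := by
  refine suffix_of_between ?_
  have := b.dist_add zero_le h
  rwa [b.map_zero] at this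

/-- Betweenness holds in each flat, and the plane is strictly convex, so the projection of the ray
to a flat stays on a line through the vertex of entry. -/
theorem flatCoord_ray_eq_smul (b : GeodesicRay (TreeOfFlats s) (base s)) {t : ℝ≥0}
    {u : List FlatLetter} (hv : (b.toFun t).flatCoord u ≠ 0) (t' : ℝ≥0) :
    ∃ c : ℝ, (b.toFun t').flatCoord u = c • (b.toFun t).flatCoord u := by
  have key : ∀ {t t' : ℝ≥0}, t ≤ t' →
      ∃ c : ℝ, (b.toFun t).flatCoord u = c • (b.toFun t').flatCoord u := by
    intro t t' h
    have h1 := b.dist_add zero_le h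
    rw [b.map_zero] at h1
    have h2 := (dist_add_dist_iff _ _ _).1 h1 (u, true)
    rw [coord_true, coord_true, coord_true, flatCoord_base] at h2
    obtain ⟨c, -, hc⟩ := dist_add_dist_eq_iff.1 h2
    exact ⟨c, by rw [← hc, AffineMap.lineMap_apply_module]; simp⟩
  rcases le_total t' t with h | h
  · exact key h
  · obtain ⟨c, hc⟩ := key h
    have hc0 : c ≠ 0 := by rintro rfl; exact hv (by rw [hc, zero_smul])
    exact ⟨c⁻¹, by rw [hc, smul_smul, inv_mul_cancel₀ hc0, one_smul]⟩

theorem norm_smul_add_rotate (v : Plane) (c : ℝ) :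
    ‖c • v + !₂[-v 1, v 0]‖ ^ 2 = (c ^ 2 + 1) * ‖v‖ ^ 2 := by
  rw [EuclideanSpace.norm_sq_eq, EuclideanSpace.norm_sq_eq]
  simp [Fin.sum_univ_two]
  ring

theorem norm_le_norm_smul_add_rotate (v : Plane) (c : ℝ) : ‖v‖ ≤ ‖c • v + !₂[-v 1, v 0]‖ := by
  refine (abs_le_of_sq_le_sq' ?_ (norm_nonneg _)).2
  rw [norm_smul_add_rotate]
  nlinarith [mul_nonneg (sq_nonneg c) (sq_nonneg ‖v‖)]

theorem flatCoord_flatPoint (u : List FlatLetter) (hu : IsReducedWord u) (v : Plane) :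
    (flatPoint s u hu v).flatCoord u = v := by
  rw [flatCoord_of_word (w := u) rfl, if_pos rfl]; rfl

theorem dist_flatPoint_flatPoint (u : List FlatLetter) (hu : IsReducedWord u) (v v' : Plane) :
    dist (flatPoint s u hu v) (flatPoint s u hu v') = dist v v' := by
  refine (dist_flatPoint (x := flatPoint s u hu v) (u := u) rfl hu v').trans ?_
  simp [flatPoint]

theorem isReducedWord_of_edgeCoord_eq_one {x : TreeOfFlats s} {u : List FlatLetter}
    (h : x.edgeCoord u = 1) : IsReducedWord u := by
  refine x.reduced.of_suffix ?_
  by_contra hn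
  rw [edgeCoord_eq_zero hn] at h
  exact zero_ne_one h

/-- A ray that crosses a flat along a segment is not better contracting than half the length of the
segment. -/
theorem exists_projection_pair (b : GeodesicRay (TreeOfFlats s) (base s)) {t : ℝ≥0}
    {u : List FlatLetter} (hv : (b.toFun t).flatCoord u ≠ 0) :
    ∃ x y p p' : TreeOfFlats s, dist x y < Metric.infDist x b.image ∧
      p ∈ nearestPoints b.image x ∧ p' ∈ nearestPoints b.image y ∧
      dist p p' = ‖(b.toFun t).flatCoord u‖ / 2 ∧ dist (base s) x ≤ 2 * t := by
  have he := ((b.toFun t).flatCoord_eq_zero_or u).resolve_left hv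
  have hu := isReducedWord_of_edgeCoord_eq_one he
  set v := (b.toFun t).flatCoord u with hv'
  have hvpos : 0 < ‖v‖ := norm_pos_iff.2 hv
  set f : ℝ → TreeOfFlats s := fun θ => flatPoint s u hu (θ • v) with hf
  have hbet : ∀ θ, 0 ≤ θ → θ ≤ 1 →
      dist (base s) (f θ) + dist (f θ) (b.toFun t) = dist (base s) (b.toFun t) :=
    fun θ h0 h1 => flat_between hu he h0 h1
  have hmem : ∀ θ, 0 ≤ θ → θ ≤ 1 → f θ ∈ b.image := fun θ h0 h1 => by
    rw [eq_ray_of_between b (hbet θ h0 h1)]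
    exact mem_range_self _
  -- `P θ` is `f θ` pushed off the ray by a quarter turn of `v`. As the ray projects into the line
  -- of `v`, the distance of `P θ` from the ray is exactly `‖v‖` for `θ` in `[0, 1]`.
  set P : ℝ → TreeOfFlats s := fun θ => flatPoint s u hu (θ • v + !₂[-v 1, v 0]) with hP
  have hlow : ∀ θ, ∀ z ∈ b.image, ‖v‖ ≤ dist (P θ) z := by
    rintro θ _ ⟨t', rfl⟩
    obtain ⟨c, hc⟩ := flatCoord_ray_eq_smul b hv t'
    refine le_trans ?_ (dist_coord_le (P θ) (b.toFun t') (u, true))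
    rw [coord_true, coord_true, hc, ← hv', hP, flatCoord_flatPoint, dist_eq_norm,
      show θ • v + !₂[-v 1, v 0] - c • v = (θ - c) • v + !₂[-v 1, v 0] by module]
    exact norm_le_norm_smul_add_rotate v _
  have hrot : ‖!₂[-v 1, v 0]‖ = ‖v‖ := by
    have := norm_smul_add_rotate v 0
    rw [zero_smul, zero_add] at this
    exact (pow_left_inj₀ (norm_nonneg _) (norm_nonneg _) two_ne_zero).1 (by rw [this]; ring)
  have hPf : ∀ θ, dist (P θ) (f θ) = ‖v‖ := by
    intro θ
    rw [hP, hf, dist_flatPoint_flatPoint, dist_eq_norm, add_sub_cancel_left]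
    exact hrot
  have hff : dist (f (1 / 2)) (f 0) = ‖v‖ / 2 := by
    rw [hf, dist_flatPoint_flatPoint, dist_eq_norm, zero_smul, sub_zero, norm_smul]
    norm_num; ring
  have hPP : dist (P (1 / 2)) (P 0) = ‖v‖ / 2 := by
    rw [hP, dist_flatPoint_flatPoint, dist_eq_norm, zero_smul, zero_add, add_sub_cancel_right,
      norm_smul]
    norm_num; ring
  obtain ⟨n1, i1⟩ := mem_nearestPoints (hmem (1 / 2) (by norm_num) (by norm_num)) (hPf _) (hlow _)
  obtain ⟨n2, -⟩ := mem_nearestPoints (hmem 0 le_rfl zero_le_one) (hPf _) (hlow _)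
  -- With half of the segment, `d(x,y) = ‖v‖ / 2` is strictly below `‖v‖`, so `y` lies in the open
  -- ball about `x` that misses the ray.
  refine ⟨P (1 / 2), P 0, _, _, ?_, n1, n2, hff, ?_⟩
  · rw [i1, hPP]; linarith
  · have h1 := hbet (1 / 2) (by norm_num) (by norm_num)
    rw [b.dist_base] at h1
    have h2 := dist_triangle (base s) (f (1 / 2)) (P (1 / 2))
    rw [dist_comm (f (1 / 2)), hPf] at h2
    have h3 := norm_flatCoord_le (b.toFun t) u
    rw [dist_comm, b.dist_base] at h3
    linarith [dist_nonneg (x := f (1 / 2)) (y := b.toFun t)]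

theorem norm_flatCoord_le_of_isContracting {b : GeodesicRay (TreeOfFlats s) (base s)} {D : ℝ≥0}
    (hb : b.IsContracting D) (t : ℝ≥0) (u : List FlatLetter) :
    ‖(b.toFun t).flatCoord u‖ ≤ 2 * D := by
  by_cases hv : (b.toFun t).flatCoord u = 0
  · rw [hv, norm_zero]; positivity
  obtain ⟨x, y, p, p', h1, h2, h3, h4, -⟩ := exists_projection_pair b hv
  have hpos : 0 < Metric.infDist x b.image := dist_nonneg.trans_lt h1
  have := hb x (Metric.infDist x b.image) Metric.disjoint_ball_infDist x
    (Metric.mem_ball_self hpos) y (by rwa [Metric.mem_ball, dist_comm]) p h2 p' h3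
  linarith

theorem norm_flatCoord_le_of_isKappaContracting {b : GeodesicRay (TreeOfFlats s) (base s)}
    {κ : ℝ → ℝ} (hκ : MonotoneOn κ (Ici 0)) (hκ0 : ∀ t, 0 ≤ t → 0 ≤ κ t) {c : ℝ} (hc : 0 ≤ c)
    (hb : ∀ x y : TreeOfFlats s, dist x y ≤ Metric.infDist x b.image →
      ∀ p ∈ nearestPoints b.image x ∪ nearestPoints b.image y,
        ∀ p' ∈ nearestPoints b.image x ∪ nearestPoints b.image y,
          dist p p' ≤ c * κ (dist (base s) x)) (t : ℝ≥0) (u : List FlatLetter) :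
    ‖(b.toFun t).flatCoord u‖ ≤ 2 * c * κ (2 * t) := by
  have ht : (0 : ℝ) ≤ 2 * t := by positivity
  by_cases hv : (b.toFun t).flatCoord u = 0
  · rw [hv, norm_zero]
    exact mul_nonneg (by positivity) (hκ0 _ ht)
  obtain ⟨x, y, p, p', h1, h2, h3, h4, h5⟩ := exists_projection_pair b hv
  have h6 := hb x y h1.le p (Or.inl h2) p' (Or.inr h3)
  have h7 := mul_le_mul_of_nonneg_left (hκ (mem_Ici.2 dist_nonneg) (mem_Ici.2 ht) h5) hc
  linarith

/-! ### Rays determined by words, and finiteness -/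

/-- The ray meets infinitely many flats. -/
def HasUnboundedWords (b : GeodesicRay (TreeOfFlats s) (base s)) : Prop :=
  ∀ n : ℕ, ∃ t, n ≤ (b.toFun t).word.length

/-- In flats of height at least `N`, the ray leaves the flat at the vertex at which it enters. -/
def HasZeroLettersFrom (b : GeodesicRay (TreeOfFlats s) (base s)) (N : ℕ) : Prop :=
  ∀ t a w, a :: w <:+ (b.toFun t).word → N ≤ w.length → a.1 = 0

/-- By `dist_base_le`, `t ≤ (height + 1) * (g t + 1)`, so the height exceeds `n` as soon as `(n + 1)
* (g t + 1) < t`. -/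
theorem hasUnboundedWords {b : GeodesicRay (TreeOfFlats s) (base s)} {g : ℝ → ℝ}
    (hb : ∀ t u, ‖(b.toFun t).flatCoord u‖ ≤ g t)
    (hg : ∀ n : ℕ, ∀ᶠ t in atTop, (n + 1) * (g t + 1) < t) : HasUnboundedWords b := by
  intro n
  obtain ⟨t, h1, h2⟩ := ((hg n).and (eventually_ge_atTop 0)).exists
  lift t to ℝ≥0 using h2
  refine ⟨t, ?_⟩
  have h3 := dist_base_le (hb t)
  rw [dist_comm, b.dist_base] at h3
  have hpos : 0 < g t + 1 := by linarith [hb t [], norm_nonneg ((b.toFun t).flatCoord [])]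
  have h4 := lt_of_mul_lt_mul_right (h1.trans_le h3) hpos.le
  have h5 : (n : ℝ) < (b.toFun t).word.length := by linarith
  exact_mod_cast h5.le

theorem exists_suffix_length (w : List FlatLetter) {n : ℕ} (h : n ≤ w.length) :
    ∃ u, u <:+ w ∧ u.length = n :=
  ⟨w.drop (w.length - n), List.drop_suffix _ _, by rw [List.length_drop]; omega⟩

theorem suffix_of_length_le {b : GeodesicRay (TreeOfFlats s) (base s)} {t t' : ℝ≥0}
    {u u' : List FlatLetter} (h : u <:+ (b.toFun t).word) (h' : u' <:+ (b.toFun t').word)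
    (hl : u.length ≤ u'.length) : u <:+ u' :=
  List.suffix_of_suffix_length_le (h.trans (word_suffix b (le_max_left t t')))
    (h'.trans (word_suffix b (le_max_right t t'))) hl

/-- Two rays that meet the same flats agree. -/
theorem eq_of_words {b b' : GeodesicRay (TreeOfFlats s) (base s)} (hb : HasUnboundedWords b)
    (h : ∀ t w, w <:+ (b.toFun t).word → ∃ t', w <:+ (b'.toFun t').word) :
    b = b' := by
  refine GeodesicRay.ext fun τ => ?_
  -- The flat `w` of height `⌊τ⌋ + 1` is entered at distance at least `τ`. The extra level makes `w`
  -- a proper suffix, so both rays have fully crossed the edge to it and share its vertex of entry.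
  obtain ⟨t, ht⟩ := hb (⌊(τ : ℝ)⌋₊ + 2)
  obtain ⟨t', ht'⟩ := h t _ (List.suffix_refl _)
  obtain ⟨w, hw, hl⟩ := exists_suffix_length (b.toFun t).word (n := ⌊(τ : ℝ)⌋₊ + 1) (by omega)
  have hne : w ≠ (b.toFun t).word := by
    rintro rfl; omega
  have hwr := (b.toFun t).reduced.of_suffix hw
  have e1 := edgeCoord_of_suffix (x := b.toFun t) hw hne (List.suffix_refl _)
  have e2 := edgeCoord_of_suffix (x := b'.toFun t') hw hne ht'
  have k1 := flat_between hwr e1 le_rfl zero_le_one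
  have k2 := flat_between hwr e2 le_rfl zero_le_one
  rw [zero_smul] at k1 k2
  have p1 := eq_ray_of_between b k1
  have p2 := eq_ray_of_between b' k2
  set P := flatPoint s w hwr 0
  have hP : (τ : ℝ) ≤ dist (base s) P := by
    have h1 := length_add_le_dist_base P
    have h2 : (P.word.length : ℝ) = ⌊(τ : ℝ)⌋₊ + 1 := by
      rw [show P.word = w from rfl, hl]; push_cast; ring
    have h3 : ‖P.pos‖ = 0 := norm_zero
    have h4 : P.t = 1 := rfl
    rw [dist_comm]
    linarith [Nat.lt_floor_add_one (τ : ℝ)]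
  have hP' : τ ≤ nndist (base s) P := hP
  have d1 := b.dist_add zero_le hP'
  have d2 := b'.dist_add zero_le hP'
  rw [← p1, b.map_zero] at d1
  rw [← p2, b'.map_zero] at d2
  refine eq_of_between d2 ?_ ?_
  · rw [b.dist_base, b'.dist_base]
  · rw [b.dist_base] at d1
    rw [b'.dist_base] at d2
    linarith

/-- After a letter of sign `ε`, a letter at position zero must again have sign `ε`, since the word
is reduced. The length `N + 1` guarantees a preceding letter even for `N = 0`. -/
theorem eq_of_hasZeroLettersFrom {b b' : GeodesicRay (TreeOfFlats s) (base s)} {N : ℕ}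
    (hb : HasUnboundedWords b) (hb' : HasUnboundedWords b') (hz : HasZeroLettersFrom b N)
    (hz' : HasZeroLettersFrom b' N) {t t' : ℝ≥0} {u : List FlatLetter} (hu : u.length = N + 1)
    (h : u <:+ (b.toFun t).word) (h' : u <:+ (b'.toFun t').word) : b = b' := by
  have key : ∀ n w t, w.length = N + 1 + n → w <:+ (b.toFun t).word →
      ∃ t', w <:+ (b'.toFun t').word := by
    intro n
    induction n with
    | zero =>
      intro w t1 hl hw
      have : w = u := (suffix_of_length_le hw h (by omega)).eq_of_length (by omega)
      exact ⟨t', this ▸ h'⟩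
    | succ n ih =>
      intro w t1 hl hw
      rcases w with _ | ⟨a, w⟩
      · simp at hl
      rw [List.length_cons] at hl
      have hw1 := (List.suffix_cons a w).trans hw
      obtain ⟨t2, ht2⟩ := ih w t1 (by omega) hw1
      obtain ⟨t3, ht3⟩ := hb' (N + 1 + n + 1)
      obtain ⟨w', hw', hl'⟩ := exists_suffix_length _ ht3
      rcases w' with _ | ⟨a', w'⟩
      · simp at hl'
      rw [List.length_cons] at hl'
      have hw'1 := (List.suffix_cons a' w').trans hw'
      have hww : w = w' := (suffix_of_length_le ht2 hw'1 (by omega)).eq_of_length (by omega)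
      subst hww
      have ha := hz _ _ _ hw (by omega)
      have ha' := hz' _ _ _ hw' (by omega)
      have r := (b.toFun t1).reduced.of_suffix hw
      have r' := (b'.toFun t3).reduced.of_suffix hw'
      rcases w with _ | ⟨c, w⟩
      · simp at hl; omega
      have q := (List.isChain_cons_cons.1 r).1
      have q' := (List.isChain_cons_cons.1 r').1
      have haa : a = a' := Prod.ext (ha.trans ha'.symm) (by grind)
      exact ⟨t3, haa ▸ hw'⟩
  refine eq_of_words hb fun t1 w hw => ?_
  obtain ⟨t2, ht2⟩ := hb (N + 1 + w.length)
  obtain ⟨w2, hw2, hl2⟩ := exists_suffix_length _ ht2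
  obtain ⟨t3, ht3⟩ := key _ w2 t2 hl2 hw2
  exact ⟨t3, (suffix_of_length_le hw hw2 (by omega)).trans ht3⟩

theorem exists_injOn_words (B : Set (GeodesicRay (TreeOfFlats s) (base s))) (N : ℕ)
    (h1 : ∀ b ∈ B, HasUnboundedWords b) (h2 : ∀ b ∈ B, HasZeroLettersFrom b N) :
    ∃ f : GeodesicRay (TreeOfFlats s) (base s) → List FlatLetter, InjOn f B ∧
      ∀ b ∈ B, (f b).length = N + 1 ∧ ∃ t, f b <:+ (b.toFun t).word := by
  have : ∀ b : GeodesicRay (TreeOfFlats s) (base s), ∃ u : List FlatLetter, b ∈ B →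
      u.length = N + 1 ∧ ∃ t, u <:+ (b.toFun t).word := by
    intro b
    by_cases hb : b ∈ B
    · obtain ⟨t, ht⟩ := h1 b hb (N + 1)
      obtain ⟨u, hu, hl⟩ := exists_suffix_length _ ht
      exact ⟨u, fun _ => ⟨hl, t, hu⟩⟩
    · exact ⟨[], fun h => absurd h hb⟩
  choose f hf using this
  refine ⟨f, fun b hb b' hb' h => ?_, hf⟩
  obtain ⟨hl, t, ht⟩ := hf b hb
  obtain ⟨-, t', ht'⟩ := hf b' hb'
  exact eq_of_hasZeroLettersFrom (h1 b hb) (h1 b' hb') (h2 b hb) (h2 b' hb') hl ht (h ▸ ht')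

/-- Segments are at most `2 D`, so letters vanish where `s > 2 D`. The ray is encoded by its first
`N + 1` letters, whose entries are at most `2 D` because the sides are at least 1. -/
theorem finite_isContracting (hs : ∀ n, 1 ≤ s n) (hs' : Tendsto s atTop atTop) (D : ℝ≥0) :
    {b : GeodesicRay (TreeOfFlats s) (base s) | b.IsContracting D}.Finite := by
  obtain ⟨N, hN⟩ := eventually_atTop.1 (hs'.eventually_gt_atTop (2 * (D : ℝ)))
  obtain ⟨f, hf, hf'⟩ := exists_injOn_words
    {b : GeodesicRay (TreeOfFlats s) (base s) | b.IsContracting D} N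
    (fun b hb => hasUnboundedWords (g := fun _ => 2 * D)
      (norm_flatCoord_le_of_isContracting hb) fun n => eventually_gt_atTop _)
    (fun b hb t a w haw hw => by
      by_contra ha
      have h1 := norm_flatCoord_le_of_isContracting hb t w
      rw [flatCoord_of_cons_suffix haw] at h1
      have h2 := scale_le_norm_latticePoint (zero_le_one.trans (hs w.length)) ha
      linarith [hN _ hw])
  refine Set.Finite.of_injOn (fun b hb => ?_) hf (finite_words (N + 1) (2 * D))
  obtain ⟨hl, t, ht⟩ := hf' b hb
  refine ⟨hl.le, fun a ha => ?_⟩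
  obtain ⟨l, w, hlw⟩ := List.append_of_mem ha
  have haw : a :: w <:+ (b.toFun t).word := (hlw ▸ List.suffix_append l (a :: w) : _ <:+ f b).trans ht
  have h1 := norm_flatCoord_le_of_isContracting hb t w
  rw [flatCoord_of_cons_suffix haw] at h1
  have h2 := le_norm_latticePoint (hs w.length) a.1
  exact ⟨h2.1.trans h1, h2.2.trans h1⟩

end TreeOfFlats

/-! ### Logarithmic contraction and countability -/

theorem one_le_logGauge {t : ℝ} (h : 0 ≤ t) : 1 ≤ logGauge t := by
  rw [logGauge, Real.le_log_iff_exp_le (by positivity)]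
  linarith

theorem monotoneOn_logGauge : MonotoneOn logGauge (Ici 0) := by
  intro x hx y _ hxy
  have : 0 < Real.exp 1 + x := add_pos_of_pos_of_nonneg (Real.exp_pos 1) hx
  exact Real.log_le_log this (by linarith)

/-- A multiple of the logarithm is eventually smaller than the cube root. -/
theorem eventually_logGauge_cube_lt (K c : ℝ) (hK : 0 ≤ K) (hc : 0 ≤ c) :
    ∀ᶠ t in atTop, K * (2 * c * logGauge (2 * t) + 1) ^ 3 < t := by
  have h1 : ∀ᶠ t : ℝ in atTop, ‖Real.log t ^ 3‖ ≤ (K * (4 * c + 1) ^ 3 + 1)⁻¹ * ‖t‖ :=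
    (Real.isLittleO_pow_log_id_atTop (n := 3)).bound (by positivity)
  filter_upwards [h1, eventually_ge_atTop (10 : ℝ)] with t h1 ht
  have he := Real.exp_one_lt_d9
  have hlog : 1 ≤ Real.log t := by
    rw [Real.le_log_iff_exp_le (by linarith)]; linarith
  -- This is `e + 2 t ≤ t ^ 2`, valid for `t ≥ 10`.
  have hg : logGauge (2 * t) ≤ 2 * Real.log t := by
    rw [logGauge, ← Real.log_rpow (by linarith)]
    refine Real.log_le_log (by positivity) ?_
    norm_num
    nlinarith
  have hg0 := one_le_logGauge (t := 2 * t) (by linarith)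
  have h2 : 2 * c * logGauge (2 * t) + 1 ≤ (4 * c + 1) * Real.log t := by nlinarith
  have h3 : (2 * c * logGauge (2 * t) + 1) ^ 3 ≤ ((4 * c + 1) * Real.log t) ^ 3 :=
    pow_le_pow_left₀ (by positivity) h2 3
  rw [Real.norm_of_nonneg (by positivity), Real.norm_of_nonneg (by linarith),
    inv_mul_eq_div, le_div_iff₀ (by positivity)] at h1
  have h4 : 0 < Real.log t ^ 3 := by positivity
  calc K * (2 * c * logGauge (2 * t) + 1) ^ 3 ≤ K * ((4 * c + 1) * Real.log t) ^ 3 :=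
        mul_le_mul_of_nonneg_left h3 hK
    _ < Real.log t ^ 3 * (K * (4 * c + 1) ^ 3 + 1) := by rw [mul_pow]; linarith
    _ ≤ t := h1

namespace TreeOfFlats

variable {s : ℕ → ℝ}

/-- Let the ray leave a flat of height `n` at time `τ` by a nonzero letter. Then `√n ≤ g τ`, hence
`τ ≤ (n + 1)(g τ + 1) ≤ (g τ + 1) ^ 3`, while `τ ≥ n`. This fails for `n ≥ T`, a bound that does not
depend on the ray. -/
theorem exists_hasZeroLettersFrom (hs : ∀ n : ℕ, √n ≤ s n) {g : ℝ → ℝ}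
    (hg : ∀ᶠ t in atTop, (g t + 1) ^ 3 < t) : ∃ N, ∀ b : GeodesicRay (TreeOfFlats s) (base s),
      (∀ t u, ‖(b.toFun t).flatCoord u‖ ≤ g t) → HasZeroLettersFrom b N := by
  obtain ⟨T, hT⟩ := eventually_atTop.1 hg
  refine ⟨⌈T⌉₊, fun b hb t a w haw hN => ?_⟩
  by_contra ha
  have he := edgeCoord_of_suffix (List.suffix_cons a w) (by simp) haw
  have hw := isReducedWord_of_edgeCoord_eq_one he
  have k1 := flat_between hw he zero_le_one le_rfl
  have p1 := eq_ray_of_between b k1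
  rw [one_smul, flatCoord_of_cons_suffix haw] at p1
  set v := latticePoint s w.length a.1
  set P := flatPoint s w hw v with hP
  set τ := nndist (base s) P
  have hn : s w.length ≤ ‖v‖ :=
    scale_le_norm_latticePoint ((Real.sqrt_nonneg _).trans (hs _)) ha
  have hv : ‖v‖ ≤ g τ := by
    have := hb τ w
    rwa [← p1, hP, flatCoord_flatPoint] at this
  have h1 := dist_base_le (hb τ)
  have h2 := length_add_le_dist_base (b.toFun τ)
  rw [dist_comm, b.dist_base, ← p1, show P.word = w from rfl] at h1 h2
  have h3 : P.t = 1 := rfl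
  have h4 : (T : ℝ) ≤ τ := by
    have : (⌈T⌉₊ : ℝ) ≤ w.length := by exact_mod_cast hN
    linarith [Nat.le_ceil T, norm_nonneg P.pos]
  have h5 := hT _ h4
  have h6 : √(w.length : ℝ) ≤ g τ := (hs _).trans (hn.trans hv)
  have h7 : (0 : ℝ) ≤ g τ := (Real.sqrt_nonneg _).trans h6
  have h8 : (w.length : ℝ) ≤ g τ ^ 2 := (Real.sqrt_le_left h7).1 h6
  have h9 : ((w.length : ℝ) + 1) * (g τ + 1) ≤ (g τ ^ 2 + 1) * (g τ + 1) :=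
    mul_le_mul_of_nonneg_right (by linarith) (by linarith)
  nlinarith [sq_nonneg (g τ)]

/-- The contraction constant is rounded up to a natural number `c`; for each `c` one `N` serves all
rays, which then inject into the countable set of words. -/
theorem countable_isKappaContracting (hs : ∀ n : ℕ, √n ≤ s n) :
    {b : GeodesicRay (TreeOfFlats s) (base s) |
      IsKappaContracting logGauge (base s) b.image}.Countable := by
  set B : ℕ → Set (GeodesicRay (TreeOfFlats s) (base s)) := fun c =>
    {b | ∀ t u, ‖(b.toFun t).flatCoord u‖ ≤ 2 * c * logGauge (2 * t)} with hB
  have hsub : {b : GeodesicRay (TreeOfFlats s) (base s) |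
      IsKappaContracting logGauge (base s) b.image} ⊆ ⋃ c, B c := by
    rintro b ⟨c, hc⟩
    refine mem_iUnion.2 ⟨⌈c⌉₊, norm_flatCoord_le_of_isKappaContracting monotoneOn_logGauge
      (fun t ht => zero_le_one.trans (one_le_logGauge ht)) (Nat.cast_nonneg _) ?_⟩
    intro x y hxy p hp p' hp'
    exact (hc x y hxy p hp p' hp').trans (mul_le_mul_of_nonneg_right (Nat.le_ceil c)
      (zero_le_one.trans (one_le_logGauge dist_nonneg)))
  refine (countable_iUnion fun c => ?_).mono hsub
  obtain ⟨N, hN⟩ := exists_hasZeroLettersFrom (s := s) hs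
    (g := fun t => 2 * c * logGauge (2 * t))
    (by simpa using eventually_logGauge_cube_lt 1 c zero_le_one (Nat.cast_nonneg _))
  obtain ⟨f, hf, -⟩ := exists_injOn_words (B c) N (fun b hb => hasUnboundedWords
      (g := fun t => 2 * c * logGauge (2 * t)) hb fun n => by
      filter_upwards [eventually_logGauge_cube_lt (n + 1) c (by positivity) (Nat.cast_nonneg _),
        eventually_ge_atTop 0] with t ht h0
      refine lt_of_le_of_lt (mul_le_mul_of_nonneg_left ?_ (by positivity)) ht
      have := one_le_logGauge (t := 2 * t) (by positivity)
      exact le_self_pow₀ (le_add_of_nonneg_left (by positivity)) (by norm_num))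
    (fun b hb => hN b hb)
  exact (mapsTo_univ f (B c)).countable_of_injOn hf countable_univ

end TreeOfFlats

/-! ### Horizontal rays and their contraction -/

namespace TreeOfFlats

variable {s : ℕ → ℝ}

/-- Points `P n` that lie in this order on geodesics from the base-point, and go to infinity, lie on
a geodesic ray. -/
theorem exists_geodesicRay (P : ℕ → TreeOfFlats s)
    (h : ∀ m n, m ≤ n → dist (base s) (P m) + dist (P m) (P n) = dist (base s) (P n))
    (hP : Tendsto (fun n => dist (base s) (P n)) atTop atTop) :
    ∃ b : GeodesicRay (TreeOfFlats s) (base s), ∀ n, P n ∈ b.image := by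
  have hz : ∀ t : ℝ≥0, ∃ z n, dist (base s) z = t ∧ ∀ m, n ≤ m →
      dist (base s) z + dist z (P m) = dist (base s) (P m) := by
    intro t
    obtain ⟨n, hn⟩ := (hP.eventually_ge_atTop (t : ℝ)).exists
    obtain ⟨z, h1, h2⟩ := isConnectable (base s) (P n) t t.2 hn
    refine ⟨z, n, h1, fun m hm => le_antisymm ?_ (dist_triangle _ _ _)⟩
    linarith [h n m hm, dist_triangle z (P n) (P m)]
  choose z N hz1 hz2 using hz
  refine ⟨⟨z, Isometry.of_dist_eq fun t t' => ?_, ?_⟩, fun n => ?_⟩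
  · rw [dist_of_between (hz2 t (max (N t) (N t')) (le_max_left _ _))
      (hz2 t' (max (N t) (N t')) (le_max_right _ _)), hz1, hz1, NNReal.dist_eq]
  · exact (dist_eq_zero.1 (hz1 0)).symm
  · set t := nndist (base s) (P n)
    refine ⟨t, dist_eq_zero.1 ?_⟩
    change dist (z t) (P n) = 0
    rw [dist_of_between (hz2 t (max (N t) n) (le_max_left _ _))
      (h n (max (N t) n) (le_max_right _ _)), hz1, coe_nndist, sub_self, abs_zero]

/-- The words with letters `((k i, 0), true)`. -/
def horizontalWord (k : ℕ → ℤ) : ℕ → List FlatLetter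
  | 0 => []
  | n + 1 => ((k n, 0), true) :: horizontalWord k n

theorem length_horizontalWord (k : ℕ → ℤ) (n : ℕ) : (horizontalWord k n).length = n := by
  induction n with
  | zero => rfl
  | succ n ih => rw [horizontalWord, List.length_cons, ih]

theorem isReducedWord_horizontalWord (k : ℕ → ℤ) (n : ℕ) : IsReducedWord (horizontalWord k n) := by
  induction n with
  | zero => exact List.isChain_nil
  | succ n ih =>
    rcases n with _ | n
    · exact List.isChain_singleton _
    · exact List.isChain_cons_cons.2 ⟨fun h => h.2 rfl, ih⟩

theorem horizontalWord_suffix (k : ℕ → ℤ) {m n : ℕ} (h : m ≤ n) :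
    horizontalWord k m <:+ horizontalWord k n := by
  induction h with
  | refl => exact List.suffix_refl _
  | step _ ih => exact ih.trans (List.suffix_cons _ _)

theorem horizontalWord_injective {k k' : ℕ → ℤ} (h : ∀ n, horizontalWord k n = horizontalWord k' n) :
    k = k' := by
  funext n
  have := h (n + 1)
  rw [horizontalWord, horizontalWord] at this
  simpa using (List.cons.inj this).1

/-- The vertex at which the `n`-th flat is entered. -/
noncomputable def horizontalVertex (s : ℕ → ℝ) (k : ℕ → ℤ) (n : ℕ) : TreeOfFlats s :=
  flatPoint s (horizontalWord k n) (isReducedWord_horizontalWord k n) 0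

theorem edgeCoord_horizontalVertex (k : ℕ → ℤ) {m n : ℕ} (h : m ≤ n) :
    (horizontalVertex s k n).edgeCoord (horizontalWord k m) = 1 := by
  rcases h.eq_or_lt with rfl | h'
  · exact edgeCoord_word (horizontalVertex s k m)
  · refine edgeCoord_of_suffix (horizontalWord_suffix k h) (fun e => ?_) (List.suffix_refl _)
    have := congrArg List.length e
    rw [length_horizontalWord, length_horizontalWord] at this
    omega

theorem horizontalVertex_between (k : ℕ → ℤ) {m n : ℕ} (h : m ≤ n) :
    dist (base s) (horizontalVertex s k m) + dist (horizontalVertex s k m) (horizontalVertex s k n) =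
      dist (base s) (horizontalVertex s k n) := by
  have := flat_between (isReducedWord_horizontalWord k m)
    (edgeCoord_horizontalVertex (s := s) k h) le_rfl zero_le_one
  rwa [zero_smul] at this

/-- The length of the path with letters `k` up to the `n`-th flat. -/
noncomputable def entryTime (s : ℕ → ℝ) (k : ℕ → ℤ) : ℕ → ℝ
  | 0 => 0
  | n + 1 => entryTime s k n + s n * |(k n : ℝ)| + 1

theorem dist_base_horizontalVertex (hs : ∀ n, 0 ≤ s n) (k : ℕ → ℤ) (n : ℕ) :
    dist (base s) (horizontalVertex s k n) = entryTime s k n := by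
  induction n with
  | zero =>
    rw [entryTime, dist_comm, (dist_base_of_word_nil (x := horizontalVertex s k 0) rfl).1]
    exact norm_zero
  | succ n ih =>
    have h := isReducedWord_horizontalWord k (n + 1)
    rw [dist_comm, dist_base_of_word_cons (x := horizontalVertex s k (n + 1)) (a := ((k n, 0), true))
      (w := horizontalWord k n) rfl, show ‖(horizontalVertex s k (n + 1)).pos‖ = 0 from norm_zero,
      show (horizontalVertex s k (n + 1)).t = 1 from rfl]
    set E := exitPoint s ((k n, 0), true) (horizontalWord k n) h
    have hE : E.edgeCoord (horizontalWord k n) = 1 := edgeCoord_word E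
    have h1 := flat_between (isReducedWord_horizontalWord k n) hE le_rfl zero_le_one
    rw [zero_smul] at h1
    have h2 : dist (horizontalVertex s k n) E = s n * |(k n : ℝ)| := by
      refine (dist_flatPoint_flatPoint _ _ _ _).trans ?_
      rw [dist_zero_left, norm_latticePoint, length_horizontalWord, abs_of_nonneg (hs n)]
      simp [Real.sqrt_sq_eq_abs]
    change dist (base s) (horizontalVertex s k n) + dist (horizontalVertex s k n) E = _ at h1
    rw [h2, ih] at h1
    rw [dist_comm E, ← h1, entryTime]
    ring

theorem natCast_le_entryTime (hs : ∀ n, 0 ≤ s n) (k : ℕ → ℤ) (n : ℕ) : n ≤ entryTime s k n := by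
  induction n with
  | zero => simp [entryTime]
  | succ n ih =>
    rw [entryTime]
    push_cast
    linarith [mul_nonneg (hs n) (abs_nonneg (k n : ℝ))]

theorem exists_horizontalRay (hs : ∀ n, 0 ≤ s n) (k : ℕ → ℤ) :
    ∃ b : GeodesicRay (TreeOfFlats s) (base s), ∀ n, horizontalVertex s k n ∈ b.image := by
  refine exists_geodesicRay _ (fun m n h => horizontalVertex_between k h) ?_
  refine tendsto_atTop_mono (fun n => ?_) tendsto_natCast_atTop_atTop
  rw [dist_base_horizontalVertex hs]
  exact natCast_le_entryTime hs k n

section Contraction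

variable {b : GeodesicRay (TreeOfFlats s) (base s)} {k : ℕ → ℤ}

/-- An interior point of the edge separates the base-point from the next vertex of the ray. The edge
to the flat of height `n + 1` occupies the unit of time that ends at `entryTime s k (n + 1)`. -/
theorem edgePoint_eq_ray (hs : ∀ n, 0 ≤ s n) (hb : ∀ n, horizontalVertex s k n ∈ b.image) (n : ℕ)
    {τ : ℝ} (h0 : 0 < τ) (h1 : τ < 1) {t : ℝ≥0} (ht : t = entryTime s k (n + 1) - 1 + τ) :
    edgePoint s (horizontalWord k (n + 1)) (isReducedWord_horizontalWord k (n + 1))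
      (List.cons_ne_nil _ _) τ h0 h1.le = b.toFun t := by
  have hV := edgeCoord_horizontalVertex (s := s) k (le_refl (n + 1))
  have hB : (base s).edgeCoord (horizontalWord k (n + 1)) = 0 :=
    edgeCoord_base (List.cons_ne_nil _ _)
  have h2 := edge_between (isReducedWord_horizontalWord k (n + 1)) (List.cons_ne_nil _ _) h0 h1
    (hB.trans_lt h0) (h1.trans_eq hV.symm)
  set e := edgePoint s (horizontalWord k (n + 1)) (isReducedWord_horizontalWord k (n + 1))
      (List.cons_ne_nil _ _) τ h0 h1.le
  have h3 : dist e (horizontalVertex s k (n + 1)) = 1 - τ := by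
    refine (dist_flatPoint (x := e) rfl _ _).trans ?_
    simp [e, edgePoint, abs_sub_comm τ, abs_of_pos (sub_pos.2 h1)]
  obtain ⟨T, hT⟩ := hb (n + 1)
  rw [h3, dist_base_horizontalVertex hs] at h2
  have h4 : nndist (base s) e = t := by
    apply NNReal.coe_injective
    rw [coe_nndist, ht]; linarith
  rw [← h4]
  refine eq_ray_of_between b (t := T) ?_
  rw [hT, h3, dist_base_horizontalVertex hs]
  exact h2

theorem edgeCoord_nonneg (x : TreeOfFlats s) (u : List FlatLetter) : 0 ≤ x.edgeCoord u := by
  rw [edgeCoord]; split_ifs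
  exacts [x.t_pos.le, zero_le_one, le_rfl]

theorem edgeCoord_le_one (x : TreeOfFlats s) (u : List FlatLetter) : x.edgeCoord u ≤ 1 := by
  rw [edgeCoord]; split_ifs
  exacts [x.t_le_one, le_rfl, zero_le_one]

theorem edgePoint_mem_image (hs : ∀ n, 0 ≤ s n) (hb : ∀ n, horizontalVertex s k n ∈ b.image) (n : ℕ)
    {τ : ℝ} (h0 : 0 < τ) (h1 : τ < 1) :
    edgePoint s (horizontalWord k (n + 1)) (isReducedWord_horizontalWord k (n + 1))
      (List.cons_ne_nil _ _) τ h0 h1.le ∈ b.image := by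
  have h2 : 0 ≤ entryTime s k (n + 1) - 1 + τ := by
    have := natCast_le_entryTime hs k (n + 1)
    push_cast at this
    linarith [(Nat.cast_nonneg n : (0 : ℝ) ≤ n)]
  rw [edgePoint_eq_ray hs hb n h0 h1 (t := ⟨_, h2⟩) rfl]
  exact mem_range_self _

/-- A point between `x` and `y` in the interior of an edge of the ray, if the edge separates them. -/
theorem exists_edgePoint_between (hs : ∀ n, 0 ≤ s n) (hb : ∀ n, horizontalVertex s k n ∈ b.image)
    {n : ℕ} {x y : TreeOfFlats s}
    (h : x.edgeCoord (horizontalWord k (n + 1)) ≠ y.edgeCoord (horizontalWord k (n + 1))) :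
    ∃ e ∈ b.image, dist x e + dist e y = dist x y ∧ e ≠ y := by
  set u := horizontalWord k (n + 1)
  have x0 := x.edgeCoord_nonneg u
  have x1 := x.edgeCoord_le_one u
  have y0 := y.edgeCoord_nonneg u
  have y1 := y.edgeCoord_le_one u
  have e0 : 0 < (x.edgeCoord u + y.edgeCoord u) / 2 := by
    rcases lt_or_gt_of_ne h with h | h <;> linarith
  have e1 : (x.edgeCoord u + y.edgeCoord u) / 2 < 1 := by
    rcases lt_or_gt_of_ne h with h | h <;> linarith
  refine ⟨_, edgePoint_mem_image hs hb n e0 e1, ?_, ?_⟩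
  · rcases lt_or_gt_of_ne h with h | h
    · exact edge_between _ _ e0 e1 (by linarith) (by linarith)
    · rw [dist_comm x, dist_comm _ y, dist_comm x y, add_comm]
      exact edge_between _ _ e0 e1 (by linarith) (by linarith)
  · intro he
    have h2 : y.edgeCoord u = (x.edgeCoord u + y.edgeCoord u) / 2 := by
      conv_lhs => rw [← he]
      exact edgeCoord_word (edgePoint s u _ _ _ e0 e1.le)
    exact h (by linarith)

/-- Otherwise the ray would contain a point of the edge strictly between `x` and `p`, nearer to `x`
than `p` is. The next lemma uses the same point against `d(x,y) ≤ d(x,b)`. -/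
theorem edgeCoord_eq_of_mem_nearestPoints (hs : ∀ n, 0 ≤ s n)
    (hb : ∀ n, horizontalVertex s k n ∈ b.image) {x p : TreeOfFlats s}
    (hp : p ∈ nearestPoints b.image x) (n : ℕ) :
    x.edgeCoord (horizontalWord k (n + 1)) = p.edgeCoord (horizontalWord k (n + 1)) := by
  by_contra h
  obtain ⟨e, he, h1, h2⟩ := exists_edgePoint_between hs hb h
  have h3 := Metric.infDist_le_dist_of_mem (x := x) he
  rw [← hp.2] at h3
  linarith [dist_pos.2 h2]

theorem edgeCoord_eq_of_dist_le (hs : ∀ n, 0 ≤ s n)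
    (hb : ∀ n, horizontalVertex s k n ∈ b.image) {x y : TreeOfFlats s}
    (hxy : dist x y ≤ Metric.infDist x b.image) (n : ℕ) :
    x.edgeCoord (horizontalWord k (n + 1)) = y.edgeCoord (horizontalWord k (n + 1)) := by
  by_contra h
  obtain ⟨e, he, h1, h2⟩ := exists_edgePoint_between hs hb h
  have h3 := Metric.infDist_le_dist_of_mem (x := x) he
  linarith [dist_pos.2 h2]

/-- The stretch from `t₀` to `t₁` overlaps the time spent on the edge. Two times `t < t'` in the
overlap have increasing edge coordinates, and betweenness puts those of `t₀` and `t₁` on opposite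
sides of them. -/
theorem edgeCoord_ray_ne (hs : ∀ n, 0 ≤ s n) (hb : ∀ n, horizontalVertex s k n ∈ b.image) {n : ℕ}
    {t₀ t₁ : ℝ≥0} (h : max (t₀ : ℝ) (entryTime s k (n + 1) - 1) < min (t₁ : ℝ) (entryTime s k (n + 1))) :
    (b.toFun t₀).edgeCoord (horizontalWord k (n + 1)) ≠
      (b.toFun t₁).edgeCoord (horizontalWord k (n + 1)) := by
  set R := entryTime s k (n + 1)
  set lo := max (t₀ : ℝ) (R - 1)
  set hi := min (t₁ : ℝ) R
  have l0 : (t₀ : ℝ) ≤ lo := le_max_left _ _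
  have l1 : R - 1 ≤ lo := le_max_right _ _
  have u0 : hi ≤ t₁ := min_le_left _ _
  have u1 : hi ≤ R := min_le_right _ _
  have key : ∀ t : ℝ≥0, lo < t → (t : ℝ) < hi →
      (b.toFun t).edgeCoord (horizontalWord k (n + 1)) = t - R + 1 := by
    intro t h1 h2
    rw [← edgePoint_eq_ray hs hb n (τ := t - R + 1) (by linarith) (by linarith) (t := t) (by ring)]
    exact edgeCoord_word (edgePoint s (horizontalWord k (n + 1)) _ _ _ _ _)
  have n0 : 0 ≤ lo := t₀.2.trans l0
  lift lo to ℝ≥0 using n0 with lo' hlo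
  lift hi to ℝ≥0 using lo'.2.trans h.le with hi' hhi
  obtain ⟨t, ht, ht'⟩ := exists_between (show lo' < hi' from h)
  obtain ⟨t', htt, ht''⟩ := exists_between ht'
  have k1 := key t ht ht'
  have k2 := key t' (ht.trans htt) ht''
  have c1 := (dist_add_dist_iff _ _ _).1
    (b.dist_add ((NNReal.coe_le_coe.1 l0).trans ht.le) htt.le) (horizontalWord k (n + 1), false)
  have c2 := (dist_add_dist_iff _ _ _).1
    (b.dist_add htt.le (ht''.le.trans (NNReal.coe_le_coe.1 u0))) (horizontalWord k (n + 1), false)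
  rw [dist_coord_false, dist_coord_false, dist_coord_false, k1, k2] at c1 c2
  have htt' : (t : ℝ) < t' := htt
  intro he
  rw [he] at c1
  grind

/-- Let `n` be the last flat entered by time `t₀`. A stretch longer than the segment in that flat
would overlap the edge that follows. -/
theorem exists_entryTime_le (hs : ∀ n, 0 ≤ s n) (hb : ∀ n, horizontalVertex s k n ∈ b.image)
    {t₀ t₁ : ℝ≥0} (hle : t₀ ≤ t₁)
    (h : ∀ n, (b.toFun t₀).edgeCoord (horizontalWord k (n + 1)) =
      (b.toFun t₁).edgeCoord (horizontalWord k (n + 1))) :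
    ∃ n, entryTime s k n ≤ t₀ ∧ (t₁ : ℝ) - t₀ ≤ s n * |(k n : ℝ)| := by
  have hle' : (t₀ : ℝ) ≤ t₁ := hle
  have hex : ∃ n, (t₀ : ℝ) < entryTime s k (n + 1) := by
    obtain ⟨n, hn⟩ := exists_nat_gt (t₀ : ℝ)
    refine ⟨n, hn.trans_le ?_⟩
    have := natCast_le_entryTime hs k (n + 1)
    push_cast at this
    linarith
  classical
  obtain ⟨n, h1, h2⟩ : ∃ n, entryTime s k n ≤ t₀ ∧ (t₀ : ℝ) < entryTime s k (n + 1) := by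
    refine ⟨Nat.find hex, ?_, Nat.find_spec hex⟩
    rcases hn : Nat.find hex with _ | m
    · exact t₀.2
    · exact not_lt.1 (Nat.find_min hex (m := m) (by omega))
  refine ⟨n, h1, ?_⟩
  by_contra hlt
  push Not at hlt
  refine edgeCoord_ray_ne hs hb (n := n) ?_ (h n)
  rcases hle'.eq_or_lt with he | hl
  · rw [he, sub_self] at hlt
    exact absurd hlt (not_lt.2 (mul_nonneg (hs n) (abs_nonneg _)))
  · rw [entryTime] at h2 ⊢
    exact max_lt (lt_min hl h2) (lt_min (by linarith) (by linarith))

/-- `x`, `y` and their projections agree in every edge of the ray, so the ray makes no progress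
along an edge between `p` and `p'`. The bound on `n` makes the estimate usable with a gauge. -/
theorem dist_nearestPoints_le (hs : ∀ n, 0 ≤ s n) (hb : ∀ n, horizontalVertex s k n ∈ b.image)
    {x y p p' : TreeOfFlats s} (hxy : dist x y ≤ Metric.infDist x b.image)
    (hp : p ∈ nearestPoints b.image x) (hp' : p' ∈ nearestPoints b.image y) :
    ∃ n : ℕ, n ≤ dist (base s) p ∧ dist p p' ≤ s n * |(k n : ℝ)| := by
  have he : ∀ n, p.edgeCoord (horizontalWord k (n + 1)) = p'.edgeCoord (horizontalWord k (n + 1)) :=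
    fun n => by
      rw [← edgeCoord_eq_of_mem_nearestPoints hs hb hp, ← edgeCoord_eq_of_mem_nearestPoints hs hb hp',
        edgeCoord_eq_of_dist_le hs hb hxy]
  obtain ⟨t₀, rfl⟩ := hp.1
  obtain ⟨t₁, rfl⟩ := hp'.1
  rw [b.dist_base, b.dist_eq]
  rcases le_total t₀ t₁ with h | h
  · obtain ⟨n, h1, h2⟩ := exists_entryTime_le hs hb h he
    refine ⟨n, (natCast_le_entryTime hs k n).trans h1, ?_⟩
    rwa [abs_sub_comm, abs_of_nonneg (sub_nonneg.2 (NNReal.coe_le_coe.2 h))]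
  · obtain ⟨n, h1, h2⟩ := exists_entryTime_le hs hb h fun n => (he n).symm
    refine ⟨n, ((natCast_le_entryTime hs k n).trans h1).trans (NNReal.coe_le_coe.2 h), ?_⟩
    rwa [abs_of_nonneg (sub_nonneg.2 (NNReal.coe_le_coe.2 h))]

end Contraction

/-- By Stewart's inequality the midpoint of two distinct nearest points would be nearer. -/
theorem nearestPoints_subsingleton (b : GeodesicRay (TreeOfFlats s) (base s)) (x : TreeOfFlats s) :
    (nearestPoints b.image x).Subsingleton := by
  have key : ∀ t t' : ℝ≥0, t ≤ t' → b.toFun t ∈ nearestPoints b.image x →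
      b.toFun t' ∈ nearestPoints b.image x → b.toFun t = b.toFun t' := by
    intro t t' h h1 h2
    have h' : (t : ℝ) ≤ t' := h
    set m := (t + t') / 2
    have hm : (m : ℝ) = (t + t') / 2 := by simp [m]
    have m1 : t ≤ m := NNReal.coe_le_coe.1 (by rw [hm]; linarith)
    have m2 : m ≤ t' := NNReal.coe_le_coe.1 (by rw [hm]; linarith)
    have st := stewart x _ _ _ (b.dist_add m1 m2)
    have hlow : Metric.infDist x b.image ≤ dist x (b.toFun m) :=
      Metric.infDist_le_dist_of_mem (mem_range_self m)
    have d1 : dist (b.toFun t) (b.toFun m) = (t' - t) / 2 := by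
      rw [b.dist_eq, hm, abs_sub_comm, abs_of_nonneg] <;> linarith
    have d2 : dist (b.toFun m) (b.toFun t') = (t' - t) / 2 := by
      rw [b.dist_eq, hm, abs_sub_comm, abs_of_nonneg] <;> linarith
    have d3 : dist (b.toFun t) (b.toFun t') = t' - t := by
      rw [b.dist_eq, abs_sub_comm, abs_of_nonneg]; linarith
    rw [h1.2, h2.2, d1, d2, d3] at st
    have h3 := pow_le_pow_left₀ Metric.infDist_nonneg hlow 2
    have h4 : (t' : ℝ) - t = 0 := by
      by_contra hne
      have hpos : 0 < (t' : ℝ) - t := lt_of_le_of_ne (by linarith) (Ne.symm hne)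
      have h5 := mul_le_mul_of_nonneg_left h3 hpos.le
      have h6 : 0 < ((t' : ℝ) - t) / 2 * (((t' : ℝ) - t) / 2) * (t' - t) := by positivity
      linarith
    rw [← dist_eq_zero, d3, h4]
  intro p hp p' hp'
  obtain ⟨t, rfl⟩ := hp.1
  obtain ⟨t', rfl⟩ := hp'.1
  rcases le_total t t' with h | h
  · exact key t t' h hp hp'
  · exact (key t' t h hp' hp).symm

theorem nearestPoints_nonempty (hs : ∀ n, 1 ≤ s n) (b : GeodesicRay (TreeOfFlats s) (base s))
    (x : TreeOfFlats s) : (nearestPoints b.image x).Nonempty := by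
  have := properSpace hs
  have hc : IsClosed b.image := b.isometry.isClosedEmbedding.isClosed_range
  obtain ⟨p, hp, h⟩ := hc.exists_infDist_eq_dist (range_nonempty _) x
  exact ⟨p, hp, h.symm⟩

/-- Both projections are compared with a projection `q` of the centre of the ball, hence the factor
2. -/
theorem isContracting_of_horizontal (hs : ∀ n, 1 ≤ s n) {k : ℕ → ℤ} {D : ℝ≥0}
    (hk : ∀ n, s n * |(k n : ℝ)| ≤ D) {b : GeodesicRay (TreeOfFlats s) (base s)}
    (hb : ∀ n, horizontalVertex s k n ∈ b.image) : b.IsContracting (2 * D) := by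
  have hs0 : ∀ n, 0 ≤ s n := fun n => zero_le_one.trans (hs n)
  intro x ρ hdis y hy y' hy' p hp p' hp'
  obtain ⟨q, hq⟩ := nearestPoints_nonempty hs b x
  have hρ : ρ ≤ Metric.infDist x b.image := by
    refine (Metric.le_infDist (range_nonempty _)).2 fun z hz => ?_
    by_contra hlt
    exact disjoint_left.1 hdis (Metric.mem_ball'.2 (not_le.1 hlt)) hz
  have near : ∀ y ∈ Metric.ball x ρ, ∀ p ∈ nearestPoints b.image y, dist q p ≤ D := by
    intro y hy p hp
    obtain ⟨n, -, h⟩ := dist_nearestPoints_le hs0 hb ((Metric.mem_ball'.1 hy).le.trans hρ) hq hp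
    exact h.trans (hk n)
  have h1 := near y hy p hp
  have h2 := near y' hy' p' hp'
  push_cast
  linarith [dist_triangle_left p p' q]

/-- The projection of `x` is at most `2 d(o,x)` from the base-point, which is where `2 * r` comes
from. -/
theorem isKappaContracting_of_horizontal (hs : ∀ n, 1 ≤ s n) {k : ℕ → ℤ} {κ : ℝ → ℝ} {c : ℝ}
    (hκ : ∀ r, 0 ≤ r → 0 ≤ c * κ r)
    (hk : ∀ (n : ℕ) (r : ℝ), n ≤ 2 * r → s n * |(k n : ℝ)| ≤ c * κ r)
    {b : GeodesicRay (TreeOfFlats s) (base s)}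
    (hb : ∀ n, horizontalVertex s k n ∈ b.image) : IsKappaContracting κ (base s) b.image := by
  have hs0 : ∀ n, 0 ≤ s n := fun n => zero_le_one.trans (hs n)
  refine ⟨c, fun x y hxy => ?_⟩
  have mixed : ∀ p ∈ nearestPoints b.image x, ∀ p' ∈ nearestPoints b.image y,
      dist p p' ≤ c * κ (dist (base s) x) := by
    intro p hp p' hp'
    obtain ⟨n, h1, h2⟩ := dist_nearestPoints_le hs0 hb hxy hp hp'
    refine h2.trans (hk n _ ?_)
    have h3 : dist x p ≤ dist x (base s) := by
      rw [hp.2]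
      exact Metric.infDist_le_dist_of_mem ⟨0, b.map_zero⟩
    linarith [dist_triangle (base s) x p, dist_comm x (base s)]
  have hnn := hκ _ (dist_nonneg (x := base s) (y := x))
  rintro p (hp | hp) p' (hp' | hp')
  · rwa [nearestPoints_subsingleton b x hp hp', dist_self]
  · exact mixed p hp p' hp'
  · rw [dist_comm]; exact mixed p' hp' p hp
  · rwa [nearestPoints_subsingleton b y hp hp', dist_self]

theorem eq_of_horizontal {k k' : ℕ → ℤ} {b : GeodesicRay (TreeOfFlats s) (base s)}
    (hb : ∀ n, horizontalVertex s k n ∈ b.image) (hb' : ∀ n, horizontalVertex s k' n ∈ b.image) :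
    k = k' := by
  refine horizontalWord_injective fun n => ?_
  obtain ⟨t, ht⟩ := hb n
  obtain ⟨t', ht'⟩ := hb' n
  have h1 : horizontalWord k n <:+ (b.toFun t).word := by rw [ht]; exact List.suffix_refl _
  have h2 : horizontalWord k' n <:+ (b.toFun t').word := by rw [ht']; exact List.suffix_refl _
  have hl : (horizontalWord k n).length = (horizontalWord k' n).length := by
    rw [length_horizontalWord, length_horizontalWord]
  exact (suffix_of_length_le h1 h2 hl.le).eq_of_length hl

/-- A set `S` of heights gives the ray that moves one square exactly in the flats with height in
`S`. -/
theorem uncountable_morseBoundary (hs : ∀ n, 1 ≤ s n) {κ : ℝ → ℝ} {c : ℝ}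
    (hκ : ∀ r, 0 ≤ r → 0 ≤ c * κ r) (h : ∀ (n : ℕ) (r : ℝ), n ≤ 2 * r → s n ≤ c * κ r) :
    Uncountable (MorseBoundary κ (TreeOfFlats s) (base s)) := by
  choose b hb using exists_horizontalRay (s := s) fun n => zero_le_one.trans (hs n)
  let k : Set ℕ → ℕ → ℤ := fun S => S.indicator 1
  have hk : ∀ S (n : ℕ) (r : ℝ), n ≤ 2 * r → s n * |(k S n : ℝ)| ≤ c * κ r := by
    intro S n r hr
    have hn : (0 : ℝ) ≤ n := n.cast_nonneg
    by_cases hS : n ∈ S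
    · simpa [k, hS] using h n r hr
    · simpa [k, hS] using hκ r (by linarith)
  let f : Set ℕ → MorseBoundary κ (TreeOfFlats s) (base s) := fun S =>
    ⟨b (k S), isKappaContracting_of_horizontal hs hκ (hk S) (hb (k S))⟩
  have : Uncountable (Set ℕ) := ⟨fun _ => by
    obtain ⟨g, hg⟩ := exists_surjective_nat (Set ℕ)
    exact Function.cantor_surjective g hg⟩
  refine Function.Injective.uncountable (f := f) fun S S' hSS => ?_
  have h1 : b (k S) = b (k S') := congrArg Subtype.val hSS
  have h2 : k S = k S' := eq_of_horizontal (hb (k S)) (h1 ▸ hb (k S'))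
  ext n
  have := congrFun h2 n
  by_cases hn : n ∈ S <;> by_cases hn' : n ∈ S' <;> simp_all [k]

theorem countable_contractingBoundary (hs : ∀ n, 1 ≤ s n) (hs' : Tendsto s atTop atTop) :
    Countable (ContractingBoundary (TreeOfFlats s) (base s)) := by
  refine Set.Countable.to_subtype (s := {b | ∃ D, GeodesicRay.IsContracting b D}) ?_
  refine (countable_iUnion fun n : ℕ => (finite_isContracting hs hs' n).countable).mono ?_
  rintro b ⟨D, hD⟩
  refine mem_iUnion.2 ⟨⌈D⌉₊, fun x ρ h y hy y' hy' p hp p' hp' => ?_⟩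
  exact (hD x ρ h y hy y' hy' p hp p' hp').trans (NNReal.coe_le_coe.2 (Nat.le_ceil D))

/-- The rays move `m` squares in the flat of height 0 and never move in a flat again. -/
theorem infinite_contractingBoundary (hs : ∀ n, 1 ≤ s n) :
    Infinite (ContractingBoundary (TreeOfFlats s) (base s)) := by
  choose b hb using exists_horizontalRay (s := s) fun n => zero_le_one.trans (hs n)
  have hk : ∀ m n : ℕ, s n * |((Pi.single 0 (m : ℤ) : ℕ → ℤ) n : ℝ)| ≤ Real.toNNReal (s 0 * m) := by
    intro m n
    rcases n with _ | n
    · simp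
    · simp
  let f : ℕ → ContractingBoundary (TreeOfFlats s) (base s) := fun m =>
    ⟨b (Pi.single 0 m), _, isContracting_of_horizontal hs (hk m) (hb _)⟩
  refine Infinite.of_injective f fun m m' h => ?_
  have h1 : b (Pi.single 0 (m : ℤ)) = b (Pi.single 0 (m' : ℤ)) := congrArg Subtype.val h
  have h2 := eq_of_horizontal (hb (Pi.single 0 (m : ℤ))) (h1 ▸ hb (Pi.single 0 (m' : ℤ)))
  simpa using congrFun h2 0

end TreeOfFlats

/-! ### Topology of the contracting boundary -/

instance GeodesicRay.instT2Space {X : Type*} [MetricSpace X] {o : X} :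
    T2Space (GeodesicRay X o) := by
  refine T2Space.of_injective_continuous (Y := C(ℝ≥0, X))
    (f := fun b => ⟨b.toFun, b.isometry.continuous⟩) (fun b b' h => GeodesicRay.ext fun t => ?_)
    continuous_induced_dom
  exact congrArg (fun f : C(ℝ≥0, X) => f t) h

/-- Each stage of the direct limit is finite and Hausdorff, hence discrete, so every set is open in
the limit. -/
theorem ContractingBoundary.discreteTopology {X : Type*} [MetricSpace X] {o : X}
    (h : ∀ D : ℝ≥0, {b : GeodesicRay X o | b.IsContracting D}.Finite) :
    DiscreteTopology (ContractingBoundary X o) := by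
  refine discreteTopology_iff_forall_isOpen.2 fun W => ?_
  refine isOpen_iSup_iff.2 fun D => isOpen_coinduced.2 ?_
  have : Finite {b : GeodesicRay X o // b.IsContracting D} := (h D).to_subtype
  exact isOpen_discrete _

namespace TreeOfFlats

theorem nonempty_homeomorph_contractingBoundary {s s' : ℕ → ℝ} (hs : ∀ n, 1 ≤ s n)
    (hs' : ∀ n, 1 ≤ s' n) (h : Tendsto s atTop atTop) (h' : Tendsto s' atTop atTop) :
    Nonempty (ContractingBoundary (TreeOfFlats s) (base s) ≃ₜ
      ContractingBoundary (TreeOfFlats s') (base s')) := by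
  have := ContractingBoundary.discreteTopology (finite_isContracting hs h)
  have := ContractingBoundary.discreteTopology (finite_isContracting hs' h')
  have := countable_contractingBoundary hs h
  have := countable_contractingBoundary hs' h'
  have := infinite_contractingBoundary hs
  have := infinite_contractingBoundary hs'
  obtain ⟨e⟩ := nonempty_equiv_of_countable
    (α := ContractingBoundary (TreeOfFlats s) (base s))
    (β := ContractingBoundary (TreeOfFlats s') (base s'))
  exact ⟨e.toHomeomorphOfDiscrete⟩

end TreeOfFlats

/-! ### The two scales and the conclusion -/

theorem one_le_sqrtScale (n : ℕ) : 1 ≤ sqrtScale n := le_max_left _ _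

theorem one_le_logScale (n : ℕ) : 1 ≤ logScale n := le_max_left _ _

theorem tendsto_sqrtScale : Tendsto sqrtScale atTop atTop :=
  tendsto_atTop_mono (fun _ => le_max_right _ _)
    (Real.tendsto_sqrt_atTop.comp tendsto_natCast_atTop_atTop)

theorem tendsto_logScale : Tendsto logScale atTop atTop :=
  tendsto_atTop_mono (fun _ => le_max_right _ _)
    (Real.tendsto_log_atTop.comp tendsto_natCast_atTop_atTop)

theorem logScale_le {n : ℕ} {r : ℝ} (h : n ≤ 2 * r) : logScale n ≤ 2 * logGauge r := by
  have hn : (0 : ℝ) ≤ n := n.cast_nonneg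
  have hr : 0 ≤ r := by linarith
  have h1 := one_le_logGauge hr
  refine max_le (by linarith) ?_
  rcases n.eq_zero_or_pos with rfl | hpos
  · simp; linarith
  have he := Real.add_one_le_exp (1 : ℝ)
  -- The factor 2 becomes a square: `n ≤ 2 r ≤ (e + r) ^ 2`.
  rw [logGauge, ← Real.log_rpow (by positivity)]
  refine Real.log_le_log (by exact_mod_cast hpos) ?_
  norm_num
  nlinarith

theorem corollary6p4 :
    -- the two rescaled trees of flats are proper CAT(0) spaces
    (ProperSpace (TreeOfFlats sqrtScale) ∧ IsCAT0 (TreeOfFlats sqrtScale)) ∧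
    (ProperSpace (TreeOfFlats logScale) ∧ IsCAT0 (TreeOfFlats logScale)) ∧
    -- they have the same contracting boundary
    Nonempty (ContractingBoundary (TreeOfFlats sqrtScale) (TreeOfFlats.base sqrtScale) ≃ₜ
      ContractingBoundary (TreeOfFlats logScale) (TreeOfFlats.base logScale)) ∧
    -- one has a countable and the other an uncountable log-Morse boundary
    Countable (MorseBoundary logGauge (TreeOfFlats sqrtScale) (TreeOfFlats.base sqrtScale)) ∧
    Uncountable (MorseBoundary logGauge (TreeOfFlats logScale) (TreeOfFlats.base logScale)) ∧
    -- in particular, their log-Morse boundaries are not homeomorphic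
    IsEmpty (MorseBoundary logGauge (TreeOfFlats sqrtScale) (TreeOfFlats.base sqrtScale) ≃ₜ
      MorseBoundary logGauge (TreeOfFlats logScale) (TreeOfFlats.base logScale)) := by
  have hc : Countable
      (MorseBoundary logGauge (TreeOfFlats sqrtScale) (TreeOfFlats.base sqrtScale)) :=
    (TreeOfFlats.countable_isKappaContracting fun _ => le_max_right _ _).to_subtype
  have hu : Uncountable
      (MorseBoundary logGauge (TreeOfFlats logScale) (TreeOfFlats.base logScale)) :=
    TreeOfFlats.uncountable_morseBoundary one_le_logScale (c := 2)
      (fun r hr => by linarith [one_le_logGauge hr]) fun n r h => logScale_le h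
  exact ⟨⟨TreeOfFlats.properSpace one_le_sqrtScale, TreeOfFlats.isCAT0⟩,
    ⟨TreeOfFlats.properSpace one_le_logScale, TreeOfFlats.isCAT0⟩,
    TreeOfFlats.nonempty_homeomorph_contractingBoundary one_le_sqrtScale one_le_logScale
      tendsto_sqrtScale tendsto_logScale, hc, hu,
    ⟨fun e => not_countable (α := MorseBoundary logGauge (TreeOfFlats logScale)
      (TreeOfFlats.base logScale)) e.symm.injective.countable⟩⟩
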